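/- \textbf{Theorem.} Let $(\Omega,\mathcal F,\Pr)$ be a probability space, $(\Xi,\mathcal A)$ a measurable space with a probability law $\mathsf P$, $\mathcal X\subseteq\mathbb R^d$ nonempty, closed and convex, with Euclidean projector $\Pi_{\mathcal X}$, and let $F:\mathbb R^d\times\Xi\to\mathbb R^d$ be a Carathéodory map ($x\mapsto F(x,z)$ is continuous for $\mathsf P$-a.e. $z$, and $z\mapsto F(x,z)$ is measurable for every $x$) such that $F(x,\cdot)$ is $\mathsf P$-integrable for every $x$. Put $T(x)=\int_\Xi F(x,z)\,d\mathsf P(z)$, let $\mathcal X_*=\{x^*\in\mathcal X:\langle T(x^*),x-x^*\rangle\ge 0\ \ \forall x\in\mathcal X\}$, and for $a>0$ let $r_a(x)=\|x-\Pi_{\mathcal X}(x-aT(x))\|$. Assume: 1. $\mathcal X_*\neq\emptyset$; 2. $T$ is Lipschitz continuous on $\mathbb R^d$ with modulus $L>0$; 3. $T$ is pseudo-monotone on $\mathbb R^d$: for all $x,y\in\mathbb R^d$, $\langle T(x),y-x\rangle\ge0$ implies $\langle T(y),y-x\rangle\ge0$; 4. the step sizes $(\alpha_n)_{n\ge0}$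 satisfy $0<\inf_{n\ge0}\alpha_n$ and $\sup_{n\ge1}\alpha_n<\frac1{\sqrt2\,L}$; 5. the batch sizes $m_n$ $(n\ge1)$ are positive integers with $\sum_{n\ge1}\frac1{m_n}<\infty$; 6. there are $p\in[2,\infty)$, $\sigma_0\ge0$ and a measurable, locally bounded function $\sigma:\mathcal X_*\to[0,\infty)$ such that for all $x\in\mathbb R^d$ and all $x^*\in\mathcal X_*$ $$\Big(\int_\Xi\|F(x,z)-T(x)\|^p\,d\mathsf P(z)\Big)^{1/p}\le\sigma(x^*)+\sigma_0\|x-x^*\|.$$ Let $X_0$ be an $\mathbb R^d$-valued random variable and let $\xi_n^{(i)},\eta_n^{(i)}$ ($n\ge1$, $1\le i\le m_n$) be independent $\Xi$-valued random variables on $\Omega$ with law $\mathsf P$, jointly independent of $X_0$. Let the stochastic forward-backward-forward (SFBF) iterates be given for $n\ge0$ by $$A_{n+1}=\frac1{m_{n+1}}\sum_{i=1}^{m_{n+1}}F(X_n,\xi_{n+1}^{(i)}),\qquad Y_n=\Pi_{\mathcal X}(X_n-\alpha_nA_{n+1}),$$ $$B_{n+1}=\frac1{m_{n+1}}\sum_{i=1}^{m_{n+1}}F(Y_n,\eta_{n+1}^{(i)}),\qquad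 X_{n+1}=Y_n+\alpha_n(A_{n+1}-B_{n+1}).$$ Then $(X_n)_{n\ge0}$ converges almost surely to a random variable $X$ with values in $\mathcal X_*$. If moreover $\mathbb E\|X_0\|^2<\infty$, then $\mathbb E[r_{\alpha_n}(X_n)^2]<\infty$ for all $n\ge0$ and $\lim_{n\to\infty}\mathbb E[r_{\alpha_n}(X_n)^2]=0$. -/

import Mathlib

open MeasureTheory ProbabilityTheory Filter Topology
open scoped NNReal ENNReal

namespace SFBF

/-- The space `ℝ^d` with its Euclidean norm and inner product. -/
abbrev Vec (d : ℕ) : Type := EuclideanSpace ℝ (Fin d)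

/-- `IsProj K x y`: the point `y` minimizes the distance to `x` over `K`. -/
def IsProj {d : ℕ} (K : Set (Vec d)) (x y : Vec d) : Prop :=
  y ∈ K ∧ ∀ z ∈ K, ‖y - x‖ ≤ ‖z - x‖

open Classical in
/-- Euclidean projector `Π_K(x) = argmin_{y ∈ K} ‖y - x‖`. For nonempty closed convex `K` the
minimizer exists and is unique, see `proj_spec` and `eq_proj`; otherwise the value `x` is used
where there is no minimizer. -/
noncomputable def proj {d : ℕ} (K : Set (Vec d)) (x : Vec d) : Vec d :=
  if h : ∃ y, IsProj K x y then h.choose else x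

theorem proj_spec {d : ℕ} {K : Set (Vec d)} (hne : K.Nonempty) (hc : IsClosed K)
    (x : Vec d) : IsProj K x (proj K x) := by
  have h : ∃ y, IsProj K x y := by
    obtain ⟨y, hy, hd⟩ := hc.exists_infDist_eq_dist hne x
    refine ⟨y, hy, fun z hz => ?_⟩
    rw [← dist_eq_norm, ← dist_eq_norm, dist_comm y, dist_comm z, ← hd]
    exact Metric.infDist_le_dist_of_mem hz
  unfold proj
  rw [dif_pos h]
  exact h.choose_spec

theorem eq_proj {d : ℕ} {K : Set (Vec d)} (hconv : Convex ℝ K) {x y : Vec d}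
    (hy : IsProj K x y) : y = proj K x := by
  have h : ∃ y, IsProj K x y := ⟨y, hy⟩
  have hp : IsProj K x (proj K x) := by
    unfold proj
    rw [dif_pos h]
    exact h.choose_spec
  have hmid : (1 / 2 : ℝ) • y + (1 / 2 : ℝ) • proj K x ∈ K :=
    hconv hy.1 hp.1 (by norm_num) (by norm_num) (by norm_num)
  have h1 : ‖y - x‖ = ‖proj K x - x‖ := le_antisymm (hy.2 _ hp.1) (hp.2 _ hy.1)
  have h2 := hy.2 _ hmid
  have h3 := parallelogram_law_with_norm ℝ (y - x) (proj K x - x)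
  have h4 : (1 / 2 : ℝ) • y + (1 / 2 : ℝ) • proj K x - x
      = (1 / 2 : ℝ) • ((y - x) + (proj K x - x)) := by
    module
  rw [h4, norm_smul] at h2
  have h5 : y - x - (proj K x - x) = y - proj K x := by abel
  rw [h5] at h3
  norm_num at h2
  have h6 : ‖y - proj K x‖ * ‖y - proj K x‖ ≤ 0 := by
    nlinarith [norm_nonneg (y - x), norm_nonneg (proj K x - x),
      norm_nonneg (y - x + (proj K x - x))]
  have h7 : ‖y - proj K x‖ = 0 := by nlinarith [norm_nonneg (y - proj K x)]
  exact sub_eq_zero.mp (norm_eq_zero.mp h7)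

/-- The set `S(T, K)` of (strong, Stampacchia) solutions of the variational inequality. -/
def solutionSet {d : ℕ} (T : Vec d → Vec d) (K : Set (Vec d)) : Set (Vec d) :=
  {x | x ∈ K ∧ ∀ y ∈ K, 0 ≤ inner ℝ (T x) (y - x)}

/-- Pseudo-monotonicity on the whole space. -/
def PseudoMonotone {d : ℕ} (T : Vec d → Vec d) : Prop :=
  ∀ x y : Vec d, 0 ≤ inner ℝ (T x) (y - x) → 0 ≤ inner ℝ (T y) (y - x)

/-- The residual function `r_a(x) = ‖x - Π_K(x - a T(x))‖`. -/
noncomputable def residual {d : ℕ} (K : Set (Vec d)) (T : Vec d → Vec d) (a : ℝ) (x : Vec d) : ℝ :=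
  ‖x - proj K (x - a • T x)‖

section Oracle

variable {d : ℕ} {Ξ : Type*} [MeasurableSpace Ξ]

/-- The random operator is a Carathéodory map: continuous in `x` for almost every `z`, measurable
in `z` for every `x`. -/
def IsCaratheodory (P : Measure Ξ) (F : Vec d → Ξ → Vec d) : Prop :=
  (∀ᵐ z ∂P, Continuous fun x => F x z) ∧ ∀ x, Measurable (F x)

/-- The averaged operator `T(x) = 𝔼[F(x, ξ)]`, where `ξ` has law `P`. -/
noncomputable def meanOp (P : Measure Ξ) (F : Vec d → Ξ → Vec d) (x : Vec d) : Vec d :=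
  ∫ z, F x z ∂P

/-- `s_p(x) = 𝔼[‖F(x, ξ) - T(x)‖^p]^(1/p)`, with values in `[0, ∞]`. -/
noncomputable def oracleDev (P : Measure Ξ) (F : Vec d → Ξ → Vec d) (p : ℝ) (x : Vec d) : ℝ≥0∞ :=
  eLpNorm (fun z => F x z - meanOp P F x) (ENNReal.ofReal p) P

/-- Variance control: for some `p ≥ 2`, `σ₀ ≥ 0` and some measurable, locally bounded function
`σ ≥ 0` on the solution set, `s_p(x) ≤ σ(x*) + σ₀ ‖x - x*‖` for all `x` and all solutions `x*`. -/
def VarianceControl (P : Measure Ξ) (F : Vec d → Ξ → Vec d) (K : Set (Vec d)) : Prop :=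
  ∃ (p σ₀ : ℝ) (σ : solutionSet (meanOp P F) K → ℝ),
    2 ≤ p ∧ 0 ≤ σ₀ ∧ (∀ xs, 0 ≤ σ xs) ∧ Measurable σ ∧
    (∀ xs, ∃ C : ℝ, ∀ᶠ ys in 𝓝 xs, σ ys ≤ C) ∧
    ∀ (x : Vec d) (xs : solutionSet (meanOp P F) K),
      oracleDev P F p x ≤ ENNReal.ofReal (σ xs + σ₀ * ‖x - (xs : Vec d)‖)

end Oracle

section Samples

variable {d : ℕ} {Ω Ξ : Type*} [MeasurableSpace Ω] [MeasurableSpace Ξ]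

/-- Index set of all the samples that are drawn: the Boolean selects `ξ` or `η`, the pair `(n, i)`
satisfies `n ≥ 1` and `1 ≤ i ≤ m n`. -/
abbrev SampleIdx (m : ℕ → ℕ) : Type :=
  Bool × {k : ℕ × ℕ // 1 ≤ k.1 ∧ k.2 ∈ Finset.Icc 1 (m k.1)}

/-- The samples `ξ_n^(i)` and `η_n^(i)` as one family. -/
def sampleFamily (m : ℕ → ℕ) (ξ η : ℕ → ℕ → Ω → Ξ) (j : SampleIdx m) : Ω → Ξ :=
  match j.1 with
  | true => ξ j.2.1.1 j.2.1.2
  | false => η j.2.1.1 j.2.1.2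

/-- The samples `ξ_n^(i)`, `η_n^(i)` (`n ≥ 1`, `1 ≤ i ≤ m n`) are independent random variables
with law `P`, and they are jointly independent of the random starting point `X₀`. -/
structure IsSampling (μ : Measure Ω) (P : Measure Ξ) (m : ℕ → ℕ) (ξ η : ℕ → ℕ → Ω → Ξ)
    (X₀ : Ω → Vec d) : Prop where
  measurable_init : Measurable X₀
  measurable_sample : ∀ j, Measurable (sampleFamily m ξ η j)
  law_sample : ∀ j, μ.map (sampleFamily m ξ η j) = P
  indep_samples : iIndepFun (sampleFamily m ξ η) μ
  indep_init : IndepFun X₀ (fun ω j => sampleFamily m ξ η j ω) μ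

end Samples

section Algorithm

variable {d : ℕ} {Ω Ξ : Type*}

/-- Mini-batch estimator `(1/M) ∑_{i=1}^M F(x, s i)`. -/
noncomputable def batchMean (F : Vec d → Ξ → Vec d) (M : ℕ) (s : ℕ → Ξ) (x : Vec d) : Vec d :=
  (1 / (M : ℝ)) • ∑ i ∈ Finset.Icc 1 M, F x (s i)

/-- One step `X ↦ X⁺` of the forward-backward-forward method with step size `a`, batch size `M`
and samples `s`, `t`:
`A = batch mean at X`, `Y = Π_K(X - a A)`, `B = batch mean at Y`, `X⁺ = Y + a (A - B)`. -/
noncomputable def step (K : Set (Vec d)) (F : Vec d → Ξ → Vec d) (a : ℝ) (M : ℕ) (s t : ℕ → Ξ)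
    (X : Vec d) : Vec d :=
  let A := batchMean F M s X
  let Y := proj K (X - a • A)
  let B := batchMean F M t Y
  Y + a • (A - B)

/-- The iterates `X_n` of the stochastic forward-backward-forward algorithm; the passage from `X_n`
to `X_{n+1}` uses the step size `α n`, the batch size `m (n + 1)` and the samples
`ξ_{n+1}^(i)`, `η_{n+1}^(i)`. -/
noncomputable def iterate (K : Set (Vec d)) (F : Vec d → Ξ → Vec d) (α : ℕ → ℝ) (m : ℕ → ℕ)
    (ξ η : ℕ → ℕ → Ω → Ξ) (X₀ : Ω → Vec d) : ℕ → Ω → Vec d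
  | 0, ω => X₀ ω
  | n + 1, ω => step K F (α n) (m (n + 1)) (fun i => ξ (n + 1) i ω) (fun i => η (n + 1) i ω)
      (iterate K F α m ξ η X₀ n ω)

end Algorithm

end SFBF

/-!
The proof rests on a stochastic quasi-Fejér inequality. Write `W_n = A_{n+1} - T(X_n)` and
`Z_n = B_{n+1} - T(Y_n)` for the errors of the two mini-batch estimators. For a solution `p`,
the projection inequality at `Y_n`, pseudo-monotonicity and the Lipschitz bound give, pathwise,
`‖X_{n+1} - p‖² ≤ ‖X_n - p‖² - 2 α_n ⟨Z_n, Y_n - p⟩ + R_n` with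
`R_n = 4 α_n² (‖W_n‖² + ‖Z_n‖²) - (1 - 2 α_n² L²) ‖X_n - Y_n‖²` (`norm_step_sub_sq_le`).

Suppose first that `X₀` is square integrable. The samples of a batch are independent of the point
at which they are evaluated and of each other, so their errors are orthogonal, and the mean square
of `W_n` and `Z_n` is of order `(1 + 𝔼‖X_n - p‖²) / m_{n+1}` (`memLp_batchError`). As `∑ 1 / m_n`
is finite, a deterministic recursion for `𝔼‖X_n - p‖²` shows that this sequence is bounded and
that `∑ 𝔼‖X_n - Y_n‖²` and `∑ 𝔼‖W_n‖²` are finite (`summable_and_ae_tendsto_norm_sub`). The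
residual is at most `‖X_n - Y_n‖ + α_n ‖W_n‖` (`residual_le`); hence `∑ 𝔼[r_{α_n}(X_n)²]` is finite,
which is the second claim and also gives `r_{α_n}(X_n) → 0` almost surely.

For the almost sure convergence, `⟨Z_n, Y_n - p⟩` is a martingale difference, so
`‖X_n - p‖² - ∑_{k<n} R_k` is an `L¹`-bounded supermartingale, and `‖X_n - p‖` converges almost surely
(`ae_exists_tendsto_of_almost_supermartingale`), simultaneously for all `p` in a countable dense set
of solutions. Cluster points of the iterates are solutions because the residual vanishes, and
Opial's argument concludes.

Two reductions bring the general case to this one. The integrability of `X₀` is obtained by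
truncation, which does not change the iterates on `{‖X₀‖ ≤ R}` (`ae_converges`). The map `F`
is replaced by a jointly measurable one that almost surely yields the same iterates
(`IsCaratheodory.exists_measurable`).
-/

namespace SFBF

/-! ### Projections, residuals and the solution set -/

theorem proj_inner_le_zero {d : ℕ} {K : Set (Vec d)} (hne : K.Nonempty) (hc : IsClosed K)
    (hconv : Convex ℝ K) (x : Vec d) {z : Vec d} (hz : z ∈ K) :
    inner ℝ (x - proj K x) (z - proj K x) ≤ 0 := by
  obtain ⟨hmem, hmin⟩ := proj_spec hne hc x
  have : Nonempty K := hne.to_subtype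
  refine (norm_eq_iInf_iff_real_inner_le_zero hconv hmem).1 (le_antisymm ?_ ?_) z hz
  · refine le_ciInf fun w => ?_
    rw [norm_sub_rev x, norm_sub_rev x]
    exact hmin w w.2
  · exact ciInf_le ⟨0, by rintro _ ⟨w, rfl⟩; positivity⟩ (⟨proj K x, hmem⟩ : K)

theorem proj_mem {d : ℕ} {K : Set (Vec d)} (hne : K.Nonempty) (hc : IsClosed K) (x : Vec d) :
    proj K x ∈ K :=
  (proj_spec hne hc x).1

theorem norm_proj_sub_proj_le {d : ℕ} {K : Set (Vec d)} (hne : K.Nonempty) (hc : IsClosed K)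
    (hconv : Convex ℝ K) (x y : Vec d) : ‖proj K x - proj K y‖ ≤ ‖x - y‖ := by
  have h1 := proj_inner_le_zero hne hc hconv x (proj_mem hne hc y)
  have h2 := proj_inner_le_zero hne hc hconv y (proj_mem hne hc x)
  have h3 : ‖proj K x - proj K y‖ ^ 2 ≤ inner ℝ (x - y) (proj K x - proj K y) := by
    have : inner ℝ (x - y) (proj K x - proj K y) - ‖proj K x - proj K y‖ ^ 2
        = - inner ℝ (x - proj K x) (proj K y - proj K x)
          - inner ℝ (y - proj K y) (proj K x - proj K y) := by
      rw [← real_inner_self_eq_norm_sq]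
      simp only [inner_sub_left, inner_sub_right]
      ring
    linarith
  have h4 := real_inner_le_norm (x - y) (proj K x - proj K y)
  by_contra! h
  nlinarith [norm_nonneg (x - y), norm_nonneg (proj K x - proj K y)]

theorem lipschitzWith_proj {d : ℕ} {K : Set (Vec d)} (hne : K.Nonempty) (hc : IsClosed K)
    (hconv : Convex ℝ K) : LipschitzWith 1 (proj K) :=
  LipschitzWith.of_dist_le_mul fun x y => by
    simpa [dist_eq_norm] using norm_proj_sub_proj_le hne hc hconv x y

/-- Solutions are fixed points of the projected forward step. -/
theorem proj_sub_smul_eq_self {d : ℕ} {K : Set (Vec d)} (hconv : Convex ℝ K)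
    {T : Vec d → Vec d} {p : Vec d} (hp : p ∈ solutionSet T K) {a : ℝ} (ha : 0 ≤ a) :
    proj K (p - a • T p) = p := by
  refine (eq_proj hconv ⟨hp.1, fun z hz => ?_⟩).symm
  have h := mul_nonneg ha (hp.2 z hz)
  have h1 : ‖z - (p - a • T p)‖ ^ 2
      = ‖z - p‖ ^ 2 + 2 * (a * inner ℝ (T p) (z - p)) + ‖p - (p - a • T p)‖ ^ 2 := by
    have e : z - (p - a • T p) = (z - p) + a • T p := by abel
    rw [e, norm_add_sq_real, sub_sub_cancel, real_inner_smul_right, real_inner_comm]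
  refine (sq_le_sq₀ (norm_nonneg _) (norm_nonneg _)).1 ?_
  rw [h1]
  nlinarith [sq_nonneg ‖z - p‖]

theorem isClosed_solutionSet {d : ℕ} {K : Set (Vec d)} (hc : IsClosed K) {T : Vec d → Vec d}
    (hT : Continuous T) : IsClosed (solutionSet T K) := by
  have : solutionSet T K = K ∩ ⋂ y ∈ K, {x | 0 ≤ inner ℝ (T x) (y - x)} := by
    ext x
    simp [solutionSet]
  rw [this]
  refine hc.inter (isClosed_biInter fun y _ => isClosed_le continuous_const ?_)
  fun_prop

/-- Limits of points with vanishing residual, for step sizes bounded away from zero, solve the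
variational inequality. -/
theorem mem_solutionSet_of_tendsto_residual {d : ℕ} {K : Set (Vec d)} (hne : K.Nonempty)
    (hc : IsClosed K) (hconv : Convex ℝ K) {T : Vec d → Vec d} (hT : Continuous T)
    {a : ℕ → ℝ} {amin : ℝ} (hamin : 0 < amin) (ha : ∀ n, amin ≤ a n) {x : ℕ → Vec d} {q : Vec d}
    (hx : Tendsto x atTop (𝓝 q))
    (hr : Tendsto (fun n => residual K T (a n) (x n)) atTop (𝓝 0)) : q ∈ solutionSet T K := by
  set P : ℕ → Vec d := fun n => proj K (x n - a n • T (x n)) with hP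
  have hPx : Tendsto (fun n => x n - P n) atTop (𝓝 0) := by
    rw [tendsto_zero_iff_norm_tendsto_zero]
    exact hr
  have hPq : Tendsto P atTop (𝓝 q) := by
    simpa using hx.sub hPx
  refine ⟨hc.mem_of_tendsto hPq (Eventually.of_forall fun n => proj_mem hne hc _), fun y hy => ?_⟩
  have key : ∀ n, -(amin⁻¹ * (‖x n - P n‖ * ‖y - P n‖)) ≤ inner ℝ (T (x n)) (y - P n) := by
    intro n
    have h1 := proj_inner_le_zero hne hc hconv (x n - a n • T (x n)) hy
    have h2 : inner ℝ (x n - P n) (y - P n) ≤ a n * inner ℝ (T (x n)) (y - P n) := by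
      have e : x n - a n • T (x n) - P n = (x n - P n) - a n • T (x n) := by abel
      rw [show proj K (x n - a n • T (x n)) = P n from rfl, e, inner_sub_left,
        real_inner_smul_left] at h1
      linarith
    have h3 := neg_le_of_abs_le (abs_real_inner_le_norm (x n - P n) (y - P n))
    have han : 0 < a n := hamin.trans_le (ha n)
    have h5 : (a n)⁻¹ ≤ amin⁻¹ := inv_anti₀ hamin (ha n)
    have h6 : -((a n)⁻¹ * (‖x n - P n‖ * ‖y - P n‖)) ≤ inner ℝ (T (x n)) (y - P n) := by
      have : -(‖x n - P n‖ * ‖y - P n‖) ≤ a n * inner ℝ (T (x n)) (y - P n) := h3.trans h2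
      rw [← mul_neg, inv_mul_le_iff₀ han]
      exact this
    have h7 := mul_le_mul_of_nonneg_right h5
      (mul_nonneg (norm_nonneg (x n - P n)) (norm_nonneg (y - P n)))
    linarith
  have hl : Tendsto (fun n => -(amin⁻¹ * (‖x n - P n‖ * ‖y - P n‖))) atTop (𝓝 0) := by
    simpa using ((hPx.norm.mul ((tendsto_const_nhds (x := y)).sub hPq).norm).const_mul amin⁻¹).neg
  have hl2 : Tendsto (fun n => inner ℝ (T (x n)) (y - P n)) atTop (𝓝 (inner ℝ (T q) (y - q))) :=
    ((hT.tendsto q).comp hx).inner (tendsto_const_nhds.sub hPq)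
  exact le_of_tendsto_of_tendsto' hl hl2 key

/-- Opial's argument in finite dimension: it suffices that the distances to a dense subset of the
target set converge. -/
theorem exists_tendsto_of_forall_dist_tendsto {d : ℕ} {S D : Set (Vec d)} (hDne : D.Nonempty)
    (hSD : S ⊆ closure D) {x : ℕ → Vec d}
    (hD : ∀ p ∈ D, ∃ l, Tendsto (fun n => ‖x n - p‖) atTop (𝓝 l))
    (hcl : ∀ q, ∀ φ : ℕ → ℕ, StrictMono φ → Tendsto (x ∘ φ) atTop (𝓝 q) → q ∈ S) :
    ∃ q ∈ S, Tendsto x atTop (𝓝 q) := by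
  obtain ⟨p₀, hp₀⟩ := hDne
  obtain ⟨l₀, hl₀⟩ := hD p₀ hp₀
  obtain ⟨R, hR⟩ := hl₀.bddAbove_range
  have hb : ∀ n, x n ∈ Metric.closedBall p₀ R := fun n => by
    rw [Metric.mem_closedBall, dist_eq_norm]
    exact hR ⟨n, rfl⟩
  obtain ⟨q, -, φ, hφ, hq⟩ := (isCompact_closedBall p₀ R).tendsto_subseq hb
  have hqS := hcl q φ hφ hq
  refine ⟨q, hqS, ?_⟩
  rw [Metric.tendsto_atTop']
  intro ε hε
  obtain ⟨p, hp, hpq⟩ := Metric.mem_closure_iff.1 (hSD hqS) (ε / 2) (by positivity)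
  obtain ⟨l, hl⟩ := hD p hp
  have hl' : l = ‖q - p‖ :=
    tendsto_nhds_unique (hl.comp hφ.tendsto_atTop) ((hq.sub_const p).norm)
  have hlt : l < ε / 2 := by rwa [hl', ← dist_eq_norm]
  obtain ⟨N, hN⟩ := eventually_atTop.1 (hl.eventually (gt_mem_nhds hlt))
  refine ⟨N, fun n hn => ?_⟩
  have h1 := dist_triangle_right (x n) q p
  rw [dist_eq_norm (x n) p] at h1
  linarith [hN n hn.le]

/-! ### Pathwise estimates for one step -/

/-- Stochastic quasi-Fejér inequality: one step of the method decreases the squared distance to a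
solution, up to the oracle errors `A - T x` and `B - T y`. Pseudo-monotonicity is used once, to
discard `⟨T y, y - p⟩ ≥ 0`. -/
theorem norm_step_sub_sq_le {d : ℕ} {K : Set (Vec d)} (hne : K.Nonempty) (hc : IsClosed K)
    (hconv : Convex ℝ K) {T : Vec d → Vec d} {L : ℝ≥0} (hT : LipschitzWith L T)
    (hmono : PseudoMonotone T) {p : Vec d} (hp : p ∈ solutionSet T K) {a : ℝ} (ha : 0 ≤ a)
    {x y A B : Vec d} (hy : y = proj K (x - a • A)) :
    ‖y + a • (A - B) - p‖ ^ 2 ≤ ‖x - p‖ ^ 2 - 2 * a * inner ℝ (B - T y) (y - p)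
      + (4 * a ^ 2 * (‖A - T x‖ ^ 2 + ‖B - T y‖ ^ 2)
        - (1 - 2 * a ^ 2 * (L : ℝ) ^ 2) * ‖x - y‖ ^ 2) := by
  have hyK : y ∈ K := hy ▸ proj_mem hne hc _
  have h1 : inner ℝ (x - a • A - y) (p - y) ≤ 0 :=
    hy ▸ proj_inner_le_zero hne hc hconv (x - a • A) hp.1
  have h2 : 0 ≤ inner ℝ (T y) (y - p) := hmono p y (hp.2 y hyK)
  have h3 : ‖y + a • (A - B) - p‖ ^ 2
      = ‖x - p‖ ^ 2 - ‖x - y‖ ^ 2 - 2 * a * inner ℝ (B - T y) (y - p)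
        - 2 * a * inner ℝ (T y) (y - p) + 2 * inner ℝ (x - a • A - y) (p - y)
        + a ^ 2 * ‖A - B‖ ^ 2 := by
    simp only [← real_inner_self_eq_norm_sq, inner_sub_left, inner_sub_right, inner_add_left,
      inner_add_right, real_inner_smul_left, real_inner_smul_right]
    rw [real_inner_comm p x, real_inner_comm p y, real_inner_comm x y, real_inner_comm p A,
      real_inner_comm p B, real_inner_comm y A, real_inner_comm y B, real_inner_comm A B]
    ring
  have h4 : ‖T x - T y‖ ≤ L * ‖x - y‖ := by
    simpa [dist_eq_norm] using hT.dist_le_mul x y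
  have h5 : ‖A - B‖ ^ 2
      ≤ 2 * (L : ℝ) ^ 2 * ‖x - y‖ ^ 2 + 4 * (‖A - T x‖ ^ 2 + ‖B - T y‖ ^ 2) := by
    have e : A - B = (T x - T y) + ((A - T x) - (B - T y)) := by abel
    have n1 : ‖A - B‖ ≤ L * ‖x - y‖ + (‖A - T x‖ + ‖B - T y‖) := by
      rw [e]
      exact (norm_add_le _ _).trans (add_le_add h4 (norm_sub_le _ _))
    have n2 := pow_le_pow_left₀ (norm_nonneg _) n1 2
    nlinarith [sq_nonneg (L * ‖x - y‖ - (‖A - T x‖ + ‖B - T y‖)),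
      sq_nonneg (‖A - T x‖ - ‖B - T y‖)]
  have h6 := mul_le_mul_of_nonneg_left h5 (sq_nonneg a)
  have h7 := mul_nonneg ha h2
  rw [h3]
  linarith

theorem norm_midpoint_sub_le {d : ℕ} {K : Set (Vec d)} (hne : K.Nonempty) (hc : IsClosed K)
    (hconv : Convex ℝ K) {T : Vec d → Vec d} {L : ℝ≥0} (hT : LipschitzWith L T) {p : Vec d}
    (hp : p ∈ solutionSet T K) {a : ℝ} (ha : 0 ≤ a) (x A : Vec d) :
    ‖proj K (x - a • A) - p‖ ≤ (1 + a * L) * ‖x - p‖ + a * ‖A - T x‖ := by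
  have h4 : ‖T x - T p‖ ≤ L * ‖x - p‖ := by
    simpa [dist_eq_norm] using hT.dist_le_mul x p
  calc ‖proj K (x - a • A) - p‖ = ‖proj K (x - a • A) - proj K (p - a • T p)‖ := by
        rw [proj_sub_smul_eq_self hconv hp ha]
    _ ≤ ‖(x - a • A) - (p - a • T p)‖ := norm_proj_sub_proj_le hne hc hconv _ _
    _ = ‖(x - p) - (a • (A - T x) + a • (T x - T p))‖ := by congr 1; module
    _ ≤ ‖x - p‖ + (a * ‖A - T x‖ + a * ‖T x - T p‖) := by
        refine (norm_sub_le _ _).trans (add_le_add le_rfl ((norm_add_le _ _).trans ?_))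
        rw [norm_smul, norm_smul, Real.norm_of_nonneg ha]
    _ ≤ _ := by nlinarith [mul_le_mul_of_nonneg_left h4 ha]

theorem residual_le {d : ℕ} {K : Set (Vec d)} (hne : K.Nonempty) (hc : IsClosed K)
    (hconv : Convex ℝ K) (T : Vec d → Vec d) {a : ℝ} (ha : 0 ≤ a) (x A : Vec d) :
    residual K T a x ≤ ‖x - proj K (x - a • A)‖ + a * ‖A - T x‖ := by
  have h := norm_proj_sub_proj_le hne hc hconv (x - a • A) (x - a • T x)
  have e : x - a • A - (x - a • T x) = -(a • (A - T x)) := by module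
  rw [e, norm_neg, norm_smul, Real.norm_of_nonneg ha] at h
  have h2 := norm_sub_le_norm_sub_add_norm_sub x (proj K (x - a • A)) (proj K (x - a • T x))
  unfold residual
  linarith

/-! ### A deterministic recursion -/

/-- Deterministic Robbins–Siegmund lemma: an almost decreasing sequence with summable relative
errors is bounded, and its decrements are summable. -/
theorem bddAbove_and_summable_of_recursion {u v e : ℕ → ℝ} (hu : ∀ n, 0 ≤ u n)
    (hv : ∀ n, 0 ≤ v n) (he : ∀ n, 0 ≤ e n) (hes : Summable e)
    (h : ∀ n, u (n + 1) + v n ≤ u n + e n * (1 + u n)) :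
    (∃ C, ∀ n, u n ≤ C) ∧ Summable v := by
  have hb : ∀ n, 1 + u n ≤ (1 + u 0) * Real.exp (∑ k ∈ Finset.range n, e k) := by
    intro n
    induction n with
    | zero => simp
    | succ n ih =>
      rw [Finset.sum_range_succ, Real.exp_add, ← mul_assoc]
      calc 1 + u (n + 1) ≤ (1 + u n) * (1 + e n) := by linarith [h n, hv n]
        _ ≤ (1 + u n) * Real.exp (e n) :=
            mul_le_mul_of_nonneg_left (by linarith [Real.add_one_le_exp (e n)])
              (by linarith [hu n])
        _ ≤ _ := mul_le_mul_of_nonneg_right ih (Real.exp_pos _).le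
  set C := (1 + u 0) * Real.exp (∑' k, e k) with hC
  have hbC : ∀ n, 1 + u n ≤ C := fun n =>
    (hb n).trans (mul_le_mul_of_nonneg_left
      (Real.exp_le_exp.2 (hes.sum_le_tsum _ fun k _ => he k)) (by linarith [hu 0]))
  refine ⟨⟨C, fun n => by linarith [hbC n]⟩, ?_⟩
  refine summable_of_sum_range_le (c := u 0 + C * ∑' k, e k) hv fun n => ?_
  have hsum : ∑ k ∈ Finset.range n, v k + u n ≤ u 0 + ∑ k ∈ Finset.range n, e k * C := by
    induction n with
    | zero => simp
    | succ n ih =>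
      rw [Finset.sum_range_succ, Finset.sum_range_succ]
      have := mul_le_mul_of_nonneg_left (hbC n) (he n)
      linarith [h n]
  have h2 : ∑ k ∈ Finset.range n, e k * C ≤ C * ∑' k, e k := by
    rw [← Finset.sum_mul, mul_comm]
    exact mul_le_mul_of_nonneg_left (hes.sum_le_tsum _ fun k _ => he k)
      (by linarith [hbC 0, hu 0])
  linarith [hu n]

/-! ### Almost supermartingales -/

theorem ae_summable_of_summable_integral_norm {Ω : Type*} [MeasurableSpace Ω] {μ : Measure Ω}
    {R : ℕ → Ω → ℝ} (hR : ∀ n, Integrable (R n) μ)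
    (hs : Summable fun n => ∫ ω, ‖R n ω‖ ∂μ) :
    ∀ᵐ ω ∂μ, Summable fun n => R n ω := by
  have h : ∑' n, eLpNorm (R n) 1 μ ≠ ∞ := by
    have e : ∀ n, eLpNorm (R n) 1 μ = ENNReal.ofReal (∫ ω, ‖R n ω‖ ∂μ) := fun n => by
      rw [eLpNorm_one_eq_lintegral_enorm, ofReal_integral_norm_eq_lintegral_enorm (hR n)]
    simp_rw [e]
    exact hs.tsum_ofReal_ne_top
  filter_upwards [summable_norm_of_tsum_eLpNorm_ne_top le_rfl
    (fun n => (hR n).aestronglyMeasurable) h] with ω hω using hω.of_norm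

/-- Almost sure convergence of an `L¹`-bounded nonnegative process that decreases up to a
martingale difference `N` and an error `R` with summable `L¹` norms: subtracting the accumulated
errors leaves an `L¹`-bounded supermartingale. -/
theorem ae_exists_tendsto_of_almost_supermartingale {Ω : Type*} {mΩ : MeasurableSpace Ω}
    {μ : Measure Ω} [IsProbabilityMeasure μ] (𝒢 : Filtration ℕ mΩ) {V R N : ℕ → Ω → ℝ} {C : ℝ}
    (hV0 : ∀ n ω, 0 ≤ V n ω) (hVm : ∀ n, Measurable[𝒢 n] (V n)) (hV : ∀ n, Integrable (V n) μ)
    (hVC : ∀ n, ∫ ω, V n ω ∂μ ≤ C) (hRm : ∀ n, Measurable[𝒢 (n + 1)] (R n))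
    (hR : ∀ n, Integrable (R n) μ) (hRs : Summable fun n => ∫ ω, ‖R n ω‖ ∂μ)
    (hN : ∀ n, Integrable (N n) μ)
    (hN0 : ∀ n s, MeasurableSet[𝒢 n] s → ∫ ω in s, N n ω ∂μ = 0)
    (h : ∀ n ω, V (n + 1) ω ≤ V n ω - N n ω + R n ω) :
    ∀ᵐ ω ∂μ, ∃ l, Tendsto (fun n => V n ω) atTop (𝓝 l) := by
  set U : ℕ → Ω → ℝ := fun n ω => (∑ k ∈ Finset.range n, R k ω) - V n ω with hU
  have hSint : ∀ n, Integrable (fun ω => ∑ k ∈ Finset.range n, R k ω) μ := fun n =>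
    integrable_finsetSum _ fun k _ => hR k
  have hUint : ∀ n, Integrable (U n) μ := fun n => (hSint n).sub (hV n)
  have hUm : ∀ n, Measurable[𝒢 n] (U n) := fun n =>
    (Finset.measurable_fun_sum _ fun k hk => (hRm k).mono
      (𝒢.mono (Nat.succ_le_of_lt (Finset.mem_range.1 hk))) le_rfl).sub (hVm n)
  have hsub : Submartingale U 𝒢 μ := by
    refine submartingale_of_setIntegral_le_succ (fun n => (hUm n).stronglyMeasurable) hUint
      fun n s hs => ?_
    have h1 : ∫ ω in s, (U n ω + N n ω) ∂μ ≤ ∫ ω in s, U (n + 1) ω ∂μ := by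
      refine setIntegral_mono ((hUint n).add (hN n)).integrableOn (hUint _).integrableOn
        fun ω => ?_
      have := h n ω
      simp only [hU, Finset.sum_range_succ]
      linarith
    rwa [integral_add (hUint n).integrableOn (hN n).integrableOn, hN0 n s hs, add_zero] at h1
  have hbdd : ∀ n, eLpNorm (U n) 1 μ ≤ (((∑' k, ∫ ω, ‖R k ω‖ ∂μ) + C).toNNReal : ℝ≥0) := by
    intro n
    rw [eLpNorm_one_eq_lintegral_enorm, ← ofReal_integral_norm_eq_lintegral_enorm (hUint n)]
    refine ENNReal.ofReal_le_ofReal ?_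
    have hb : ∀ ω, ‖U n ω‖ ≤ (∑ k ∈ Finset.range n, ‖R k ω‖) + V n ω := fun ω => by
      refine (norm_sub_le _ _).trans (add_le_add (norm_sum_le _ _) ?_)
      rw [Real.norm_of_nonneg (hV0 n ω)]
    have hi : Integrable (fun ω => ∑ k ∈ Finset.range n, ‖R k ω‖) μ :=
      integrable_finsetSum _ fun k _ => (hR k).norm
    calc ∫ ω, ‖U n ω‖ ∂μ ≤ ∫ ω, ((∑ k ∈ Finset.range n, ‖R k ω‖) + V n ω) ∂μ :=
          integral_mono (hUint n).norm (hi.add (hV n)) hb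
      _ = ∑ k ∈ Finset.range n, ∫ ω, ‖R k ω‖ ∂μ + ∫ ω, V n ω ∂μ := by
          rw [integral_add hi (hV n), integral_finsetSum _ fun k _ => (hR k).norm]
      _ ≤ _ := add_le_add (hRs.sum_le_tsum _ fun k _ => integral_nonneg fun ω => norm_nonneg _)
          (hVC n)
  filter_upwards [hsub.exists_ae_tendsto_of_bdd hbdd,
    ae_summable_of_summable_integral_norm hR hRs] with ω ⟨l, hl⟩ hω
  refine ⟨_, (hω.hasSum.tendsto_sum_nat.sub hl).congr fun n => ?_⟩
  simp [hU]

/-! ### Oracle errors of independent samples -/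

theorem integrable_inner_of_memLp_two {d : ℕ} {Ω : Type*} [MeasurableSpace Ω] {μ : Measure Ω}
    {f g : Ω → Vec d} (hf : MemLp f 2 μ) (hg : MemLp g 2 μ) :
    Integrable (fun ω => (inner ℝ (f ω) (g ω) : ℝ)) μ :=
  (hf.norm.integrable_mul hg.norm).mono' (hf.1.inner hg.1)
    (Eventually.of_forall fun _ => norm_inner_le_norm _ _)

theorem integrable_norm_sq_of_memLp_two {d : ℕ} {Ω : Type*} [MeasurableSpace Ω] {μ : Measure Ω}
    {f : Ω → Vec d} (hf : MemLp f 2 μ) : Integrable (fun ω => ‖f ω‖ ^ 2) μ :=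
  (memLp_two_iff_integrable_sq_norm hf.1).1 hf

theorem batchMean_sub_eq {d : ℕ} {Ξ : Type*} (F : Vec d → Ξ → Vec d) {M : ℕ} (hM : 1 ≤ M) (s : ℕ → Ξ) (x t : Vec d) :
    batchMean F M s x - t = (1 / (M : ℝ)) • ∑ i ∈ Finset.Icc 1 M, (F x (s i) - t) := by
  have hM0 : (M : ℝ) ≠ 0 := by positivity
  rw [batchMean, Finset.sum_sub_distrib, smul_sub]
  congr 1
  simp [← Nat.cast_smul_eq_nsmul ℝ, smul_smul, hM0]

section Errors

variable {d : ℕ} {Ω Ξ : Type*} [MeasurableSpace Ω] [MeasurableSpace Ξ]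

/-- The oracle error at `V` of a sample independent of `(V, Q)` is orthogonal to `Q`. -/
theorem integral_inner_oracleError_eq_zero {μ : Measure Ω} [IsProbabilityMeasure μ]
    {P : Measure Ξ} [IsProbabilityMeasure P] {F : Vec d → Ξ → Vec d}
    (hF : Measurable (Function.uncurry F)) (hFint : ∀ x, Integrable (F x) P)
    (hT : Measurable (meanOp P F)) {V Q : Ω → Vec d} {ζ : Ω → Ξ} (hV : Measurable V)
    (hQ : Measurable Q) (hζ : Measurable ζ) (hlaw : μ.map ζ = P)
    (hind : IndepFun (fun ω => (V ω, Q ω)) ζ μ) (hQ2 : MemLp Q 2 μ)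
    (hD2 : MemLp (fun ω => F (V ω) (ζ ω) - meanOp P F (V ω)) 2 μ) :
    ∫ ω, inner ℝ (F (V ω) (ζ ω) - meanOp P F (V ω)) (Q ω) ∂μ = 0 := by
  set g : (Vec d × Vec d) × Ξ → ℝ := fun w => inner ℝ (F w.1.1 w.2 - meanOp P F w.1.1) w.1.2
  have hg : Measurable g :=
    ((hF.comp (measurable_fst.fst.prodMk measurable_snd)).sub
      (hT.comp measurable_fst.fst)).inner measurable_fst.snd
  have hpair : Measurable fun ω => ((V ω, Q ω), ζ ω) := (hV.prodMk hQ).prodMk hζ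
  have hmap := hind.map_prod_eq_prod_map_map (hV.prodMk hQ).aemeasurable hζ.aemeasurable
  rw [hlaw] at hmap
  have hint : Integrable g (μ.map fun ω => ((V ω, Q ω), ζ ω)) :=
    (integrable_map_measure hg.aestronglyMeasurable hpair.aemeasurable).2
      (integrable_inner_of_memLp_two hD2 hQ2)
  have h1 : ∫ ω, inner ℝ (F (V ω) (ζ ω) - meanOp P F (V ω)) (Q ω) ∂μ
      = ∫ w, g w ∂(μ.map fun ω => ((V ω, Q ω), ζ ω)) :=
    (integral_map hpair.aemeasurable hg.aestronglyMeasurable).symm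
  have : IsProbabilityMeasure (μ.map fun ω => (V ω, Q ω)) :=
    Measure.isProbabilityMeasure_map (hV.prodMk hQ).aemeasurable
  rw [h1, hmap, integral_prod g (hmap ▸ hint)]
  refine integral_eq_zero_of_ae (Eventually.of_forall fun w => ?_)
  have h2 : Integrable (fun z => F w.1 z - meanOp P F w.1) P :=
    (hFint w.1).sub (integrable_const _)
  have h3 : ∫ z, (F w.1 z - meanOp P F w.1) ∂P = 0 := by
    rw [integral_sub (hFint w.1) (integrable_const _)]
    simp [meanOp]
  calc ∫ z, g (w, z) ∂P = ∫ z, inner ℝ w.2 (F w.1 z - meanOp P F w.1) ∂P :=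
        integral_congr_ae (Eventually.of_forall fun z => real_inner_comm _ _)
    _ = 0 := by rw [integral_inner h2, h3, inner_zero_right]

/-- Second moment of the oracle error at an independent random point. -/
theorem memLp_oracleError {μ : Measure Ω} [IsProbabilityMeasure μ]
    {P : Measure Ξ} [IsProbabilityMeasure P] {F : Vec d → Ξ → Vec d}
    (hF : Measurable (Function.uncurry F))
    (hT : Measurable (meanOp P F)) {p : Vec d} {c : ℝ} (hc : 0 ≤ c)
    (hvar : ∀ x, ∫⁻ z, ‖F x z - meanOp P F x‖ₑ ^ 2 ∂P ≤ ENNReal.ofReal (c * (1 + ‖x - p‖ ^ 2)))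
    {V : Ω → Vec d} {ζ : Ω → Ξ} (hV : Measurable V) (hζ : Measurable ζ) (hlaw : μ.map ζ = P)
    (hind : IndepFun V ζ μ) (hV2 : MemLp (fun ω => V ω - p) 2 μ) :
    MemLp (fun ω => F (V ω) (ζ ω) - meanOp P F (V ω)) 2 μ ∧
      ∫ ω, ‖F (V ω) (ζ ω) - meanOp P F (V ω)‖ ^ 2 ∂μ ≤ c * (1 + ∫ ω, ‖V ω - p‖ ^ 2 ∂μ) := by
  set g : Vec d × Ξ → ℝ≥0∞ := fun w => ‖F w.1 w.2 - meanOp P F w.1‖ₑ ^ 2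
  have hg : Measurable g :=
    ((hF.comp (measurable_fst.prodMk measurable_snd)).sub
      (hT.comp measurable_fst)).enorm.pow_const 2
  have hpair : Measurable fun ω => (V ω, ζ ω) := hV.prodMk hζ
  have hmap := hind.map_prod_eq_prod_map_map hV.aemeasurable hζ.aemeasurable
  rw [hlaw] at hmap
  have hVint := integrable_norm_sq_of_memLp_two hV2
  have hbint : Integrable (fun ω => c * (1 + ‖V ω - p‖ ^ 2)) μ :=
    ((integrable_const 1).add hVint).const_mul c
  have hbeq : ∫ ω, c * (1 + ‖V ω - p‖ ^ 2) ∂μ = c * (1 + ∫ ω, ‖V ω - p‖ ^ 2 ∂μ) := by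
    rw [integral_const_mul, integral_add (integrable_const 1) hVint]
    simp
  have hle : ∫⁻ ω, ‖F (V ω) (ζ ω) - meanOp P F (V ω)‖ₑ ^ 2 ∂μ
      ≤ ENNReal.ofReal (c * (1 + ∫ ω, ‖V ω - p‖ ^ 2 ∂μ)) := by
    calc ∫⁻ ω, ‖F (V ω) (ζ ω) - meanOp P F (V ω)‖ₑ ^ 2 ∂μ
        = ∫⁻ w, g w ∂(μ.map fun ω => (V ω, ζ ω)) := (lintegral_map hg hpair).symm
      _ = ∫⁻ v, ∫⁻ z, g (v, z) ∂P ∂(μ.map V) := by rw [hmap, lintegral_prod _ hg.aemeasurable]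
      _ ≤ ∫⁻ v, ENNReal.ofReal (c * (1 + ‖v - p‖ ^ 2)) ∂(μ.map V) := lintegral_mono fun v => hvar v
      _ = ∫⁻ ω, ENNReal.ofReal (c * (1 + ‖V ω - p‖ ^ 2)) ∂μ := lintegral_map (by fun_prop) hV
      _ = ENNReal.ofReal (c * (1 + ∫ ω, ‖V ω - p‖ ^ 2 ∂μ)) := by
        rw [← hbeq, ofReal_integral_eq_lintegral_ofReal hbint
          (Eventually.of_forall fun ω => by positivity)]
  have hDm : Measurable fun ω => F (V ω) (ζ ω) - meanOp P F (V ω) :=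
    (hF.comp hpair).sub (hT.comp hV)
  have hlin : ∀ ω, ‖F (V ω) (ζ ω) - meanOp P F (V ω)‖ₑ ^ 2
      = ENNReal.ofReal (‖F (V ω) (ζ ω) - meanOp P F (V ω)‖ ^ 2) := fun ω => by
    rw [ENNReal.ofReal_pow (norm_nonneg _), ofReal_norm]
  have hDint : Integrable (fun ω => ‖F (V ω) (ζ ω) - meanOp P F (V ω)‖ ^ 2) μ := by
    refine ⟨(hDm.norm.pow_const 2).aestronglyMeasurable, ?_⟩
    rw [hasFiniteIntegral_iff_ofReal (Eventually.of_forall fun ω => by positivity)]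
    simp_rw [← hlin]
    exact hle.trans_lt ENNReal.ofReal_lt_top
  refine ⟨(memLp_two_iff_integrable_sq_norm hDm.aestronglyMeasurable).2 hDint, ?_⟩
  have h0 : 0 ≤ ∫ ω, ‖V ω - p‖ ^ 2 ∂μ := integral_nonneg fun ω => by positivity
  rw [← ENNReal.ofReal_le_ofReal_iff (by positivity), ofReal_integral_eq_lintegral_ofReal hDint
    (Eventually.of_forall fun ω => by positivity)]
  simpa only [hlin] using hle

/-- Mini-batch variance reduction: the cross terms vanish because the error of one sample is
orthogonal to that of any other. -/
theorem memLp_batchError {μ : Measure Ω} [IsProbabilityMeasure μ]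
    {P : Measure Ξ} [IsProbabilityMeasure P] {F : Vec d → Ξ → Vec d}
    (hF : Measurable (Function.uncurry F)) (hFint : ∀ x, Integrable (F x) P)
    (hT : Measurable (meanOp P F)) {p : Vec d} {c : ℝ} (hc : 0 ≤ c)
    (hvar : ∀ x, ∫⁻ z, ‖F x z - meanOp P F x‖ₑ ^ 2 ∂P ≤ ENNReal.ofReal (c * (1 + ‖x - p‖ ^ 2)))
    {V : Ω → Vec d} (hV : Measurable V) (hV2 : MemLp (fun ω => V ω - p) 2 μ)
    {M : ℕ} (hM : 1 ≤ M) {ζ : ℕ → Ω → Ξ} (hζ : ∀ i ∈ Finset.Icc 1 M, Measurable (ζ i))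
    (hlaw : ∀ i ∈ Finset.Icc 1 M, μ.map (ζ i) = P)
    (hind : ∀ i ∈ Finset.Icc 1 M, ∀ j ∈ Finset.Icc 1 M, i ≠ j →
      IndepFun (fun ω => (V ω, ζ j ω)) (ζ i) μ)
    (hind' : ∀ i ∈ Finset.Icc 1 M, IndepFun V (ζ i) μ) :
    MemLp (fun ω => batchMean F M (fun i => ζ i ω) (V ω) - meanOp P F (V ω)) 2 μ ∧
      ∫ ω, ‖batchMean F M (fun i => ζ i ω) (V ω) - meanOp P F (V ω)‖ ^ 2 ∂μ
        ≤ c / M * (1 + ∫ ω, ‖V ω - p‖ ^ 2 ∂μ) := by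
  have hM0 : (0 : ℝ) < M := by exact_mod_cast hM
  set D : ℕ → Ω → Vec d := fun i ω => F (V ω) (ζ i ω) - meanOp P F (V ω) with hD
  have hmem : ∀ i ∈ Finset.Icc 1 M, MemLp (D i) 2 μ ∧
      ∫ ω, ‖D i ω‖ ^ 2 ∂μ ≤ c * (1 + ∫ ω, ‖V ω - p‖ ^ 2 ∂μ) := fun i hi =>
    memLp_oracleError hF hT hc hvar hV (hζ i hi) (hlaw i hi) (hind' i hi) hV2
  have horth : ∀ i ∈ Finset.Icc 1 M, ∀ j ∈ Finset.Icc 1 M, i ≠ j →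
      ∫ ω, inner ℝ (D i ω) (D j ω) ∂μ = 0 := by
    intro i hi j hj hij
    have hDm : Measurable fun w : Vec d × Ξ => (w.1, F w.1 w.2 - meanOp P F w.1) :=
      measurable_fst.prodMk
        ((hF.comp (measurable_fst.prodMk measurable_snd)).sub (hT.comp measurable_fst))
    refine integral_inner_oracleError_eq_zero hF hFint hT hV
      ((hF.comp (hV.prodMk (hζ j hj))).sub (hT.comp hV)) (hζ i hi) (hlaw i hi) ?_
      (hmem j hj).1 (hmem i hi).1
    exact (hind i hi j hj hij).comp hDm measurable_id
  simp_rw [batchMean_sub_eq F hM]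
  refine ⟨(memLp_finsetSum _ fun i hi => (hmem i hi).1).const_smul (1 / (M : ℝ)), ?_⟩
  have hexp : ∀ ω, ‖(1 / (M : ℝ)) • ∑ i ∈ Finset.Icc 1 M, D i ω‖ ^ 2
      = (1 / (M : ℝ)) ^ 2 * ∑ i ∈ Finset.Icc 1 M, ∑ j ∈ Finset.Icc 1 M,
        inner ℝ (D i ω) (D j ω) := fun ω => by
    rw [norm_smul, mul_pow, Real.norm_of_nonneg (by positivity), ← real_inner_self_eq_norm_sq,
      sum_inner]
    simp_rw [inner_sum]
  have hi2 : ∀ i ∈ Finset.Icc 1 M, ∀ j ∈ Finset.Icc 1 M,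
      Integrable (fun ω => (inner ℝ (D i ω) (D j ω) : ℝ)) μ := fun i hi j hj =>
    integrable_inner_of_memLp_two (hmem i hi).1 (hmem j hj).1
  change ∫ ω, ‖(1 / (M : ℝ)) • ∑ i ∈ Finset.Icc 1 M, D i ω‖ ^ 2 ∂μ ≤ _
  simp_rw [hexp]
  rw [integral_const_mul, integral_finsetSum _ fun i hi => integrable_finsetSum _ (hi2 i hi)]
  have hrow : ∀ i ∈ Finset.Icc 1 M, ∫ ω, ∑ j ∈ Finset.Icc 1 M, inner ℝ (D i ω) (D j ω) ∂μ
      ≤ c * (1 + ∫ ω, ‖V ω - p‖ ^ 2 ∂μ) := by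
    intro i hi
    rw [integral_finsetSum _ (hi2 i hi), Finset.sum_eq_single_of_mem i hi
      fun j hj hji => horth i hi j hj hji.symm]
    simp_rw [real_inner_self_eq_norm_sq]
    exact (hmem i hi).2
  have hsum := Finset.sum_le_card_nsmul _ _ _ hrow
  rw [Nat.card_Icc, nsmul_eq_mul, Nat.add_sub_cancel] at hsum
  refine (mul_le_mul_of_nonneg_left hsum (by positivity)).trans (le_of_eq ?_)
  field_simp

/-- The mini-batch error at `V` is orthogonal to every `Q` such that `(V, Q)` is independent of
each sample. -/
theorem integral_inner_batchError_eq_zero {μ : Measure Ω} [IsProbabilityMeasure μ]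
    {P : Measure Ξ} [IsProbabilityMeasure P] {F : Vec d → Ξ → Vec d}
    (hF : Measurable (Function.uncurry F)) (hFint : ∀ x, Integrable (F x) P)
    (hT : Measurable (meanOp P F)) {p : Vec d} {c : ℝ} (hc : 0 ≤ c)
    (hvar : ∀ x, ∫⁻ z, ‖F x z - meanOp P F x‖ₑ ^ 2 ∂P ≤ ENNReal.ofReal (c * (1 + ‖x - p‖ ^ 2)))
    {V Q : Ω → Vec d} (hV : Measurable V) (hV2 : MemLp (fun ω => V ω - p) 2 μ)
    (hQ : Measurable Q) (hQ2 : MemLp Q 2 μ)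
    {M : ℕ} (hM : 1 ≤ M) {ζ : ℕ → Ω → Ξ} (hζ : ∀ i ∈ Finset.Icc 1 M, Measurable (ζ i))
    (hlaw : ∀ i ∈ Finset.Icc 1 M, μ.map (ζ i) = P)
    (hind : ∀ i ∈ Finset.Icc 1 M, IndepFun (fun ω => (V ω, Q ω)) (ζ i) μ) :
    ∫ ω, inner ℝ (batchMean F M (fun i => ζ i ω) (V ω) - meanOp P F (V ω)) (Q ω) ∂μ = 0 := by
  have hmem : ∀ i ∈ Finset.Icc 1 M, MemLp (fun ω => F (V ω) (ζ i ω) - meanOp P F (V ω)) 2 μ :=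
    fun i hi => (memLp_oracleError hF hT hc hvar hV (hζ i hi) (hlaw i hi)
      ((hind i hi).comp measurable_fst measurable_id) hV2).1
  simp_rw [batchMean_sub_eq F hM, real_inner_smul_left, sum_inner]
  rw [integral_const_mul, integral_finsetSum _ fun i hi =>
    integrable_inner_of_memLp_two (hmem i hi) hQ2, Finset.sum_eq_zero, mul_zero]
  exact fun i hi => integral_inner_oracleError_eq_zero hF hFint hT hV hQ (hζ i hi) (hlaw i hi)
    (hind i hi) hQ2 (hmem i hi)

end Errors

/-! ### The information carried by the samples -/

theorem indep_sup_left {Ω : Type*} {mΩ : MeasurableSpace Ω} {μ : Measure Ω}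
    [IsProbabilityMeasure μ] {m₁ m₂ m₃ : MeasurableSpace Ω} (h₁ : m₁ ≤ mΩ) (h₂ : m₂ ≤ mΩ)
    (h₃ : m₃ ≤ mΩ) (h : Indep m₁ (m₂ ⊔ m₃) μ) (h' : Indep m₂ m₃ μ) : Indep (m₁ ⊔ m₂) m₃ μ := by
  set p : Set (Set Ω) := {s | ∃ a b, MeasurableSet[m₁] a ∧ MeasurableSet[m₂] b ∧ s = a ∩ b}
  have hp : IsPiSystem p := by
    rintro _ ⟨a, b, ha, hb, rfl⟩ _ ⟨a', b', ha', hb', rfl⟩ -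
    exact ⟨a ∩ a', b ∩ b', ha.inter ha', hb.inter hb', Set.inter_inter_inter_comm _ _ _ _⟩
  have hgen : m₁ ⊔ m₂ = MeasurableSpace.generateFrom p := by
    refine le_antisymm (sup_le (fun a ha => ?_) fun b hb => ?_)
      (MeasurableSpace.generateFrom_le ?_)
    · exact MeasurableSpace.measurableSet_generateFrom
        ⟨a, Set.univ, ha, MeasurableSet.univ, (Set.inter_univ a).symm⟩
    · exact MeasurableSpace.measurableSet_generateFrom
        ⟨Set.univ, b, MeasurableSet.univ, hb, (Set.univ_inter b).symm⟩
    · rintro _ ⟨a, b, ha, hb, rfl⟩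
      exact MeasurableSet.inter ((le_sup_left : m₁ ≤ m₁ ⊔ m₂) _ ha)
        ((le_sup_right : m₂ ≤ m₁ ⊔ m₂) _ hb)
  refine IndepSets.indep (sup_le h₁ h₂) h₃ hp (@MeasurableSpace.isPiSystem_measurableSet Ω m₃) hgen
    (@MeasurableSpace.generateFrom_measurableSet Ω m₃).symm ?_
  rw [IndepSets_iff]
  rintro _ t ⟨a, b, ha, hb, rfl⟩ ht
  rw [Indep_iff] at h h'
  have hb' : MeasurableSet[m₂ ⊔ m₃] b := (le_sup_left : m₂ ≤ m₂ ⊔ m₃) _ hb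
  have ht' : MeasurableSet[m₂ ⊔ m₃] t := (le_sup_right : m₃ ≤ m₂ ⊔ m₃) _ ht
  rw [Set.inter_assoc, h a _ ha (MeasurableSet.inter hb' ht'), h' b t hb ht, h a b ha hb',
    mul_assoc]

section Info

variable {d : ℕ} {Ω Ξ : Type*} [MeasurableSpace Ξ]

/-- The σ-algebra generated by the starting point and the samples with index in `S`. -/
@[reducible] def info (m : ℕ → ℕ) (ξ η : ℕ → ℕ → Ω → Ξ) (X₀ : Ω → Vec d) (S : Set (SampleIdx m)) :
    MeasurableSpace Ω :=
  MeasurableSpace.comap X₀ inferInstance ⊔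
    ⨆ j ∈ S, MeasurableSpace.comap (sampleFamily m ξ η j) inferInstance

/-- Indices of the samples drawn in the first `n` steps. -/
def pastIdx (m : ℕ → ℕ) (n : ℕ) : Set (SampleIdx m) := {j | j.2.1.1 ≤ n}

/-- Indices of the samples drawn in the first `n` steps, and of the `ξ`-samples of the next one. -/
def halfIdx (m : ℕ → ℕ) (n : ℕ) : Set (SampleIdx m) :=
  {j | j.2.1.1 ≤ n ∨ (j.1 = true ∧ j.2.1.1 = n + 1)}

/-- The index of the sample `ξ_{n+1}^(i)` (for `true`) or `η_{n+1}^(i)` (for `false`). -/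
def mkIdx (m : ℕ → ℕ) (n : ℕ) (b : Bool) {i : ℕ} (hi : i ∈ Finset.Icc 1 (m (n + 1))) :
    SampleIdx m :=
  (b, ⟨(n + 1, i), Nat.le_add_left 1 n, hi⟩)

variable {m : ℕ → ℕ} {ξ η : ℕ → ℕ → Ω → Ξ} {X₀ : Ω → Vec d}

theorem info_mono {S S' : Set (SampleIdx m)} (h : S ⊆ S') :
    info m ξ η X₀ S ≤ info m ξ η X₀ S' :=
  sup_le_sup le_rfl (biSup_mono fun _ hj => h hj)

theorem measurable_info_init (S : Set (SampleIdx m)) : Measurable[info m ξ η X₀ S] X₀ :=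
  Measurable.of_comap_le le_sup_left

theorem measurable_info_sample {S : Set (SampleIdx m)} {j : SampleIdx m} (hj : j ∈ S) :
    Measurable[info m ξ η X₀ S] (sampleFamily m ξ η j) :=
  Measurable.of_comap_le (le_sup_of_le_right (le_biSup
    (fun j => MeasurableSpace.comap (sampleFamily m ξ η j) inferInstance) hj))

variable [mΩ : MeasurableSpace Ω]

theorem IsSampling.info_le {μ : Measure Ω} {P : Measure Ξ} (hs : IsSampling μ P m ξ η X₀)
    (S : Set (SampleIdx m)) : info m ξ η X₀ S ≤ mΩ :=
  sup_le hs.measurable_init.comap_le (iSup₂_le fun j _ => (hs.measurable_sample j).comap_le)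

/-- A sample is independent of the starting point and the other samples taken together. -/
theorem IsSampling.indep_info {μ : Measure Ω} [IsProbabilityMeasure μ] {P : Measure Ξ}
    (hs : IsSampling μ P m ξ η X₀) {S : Set (SampleIdx m)} {j : SampleIdx m} (hj : j ∉ S) :
    Indep (info m ξ η X₀ S) (MeasurableSpace.comap (sampleFamily m ξ η j) inferInstance) μ := by
  have hle : ∀ j, MeasurableSpace.comap (sampleFamily m ξ η j) inferInstance ≤ mΩ :=
    fun j => (hs.measurable_sample j).comap_le
  have hall : ∀ j, MeasurableSpace.comap (sampleFamily m ξ η j) inferInstance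
      ≤ MeasurableSpace.comap (fun ω j => sampleFamily m ξ η j ω) MeasurableSpace.pi := by
    intro j
    have : sampleFamily m ξ η j = (fun f : SampleIdx m → Ξ => f j) ∘
        fun ω j => sampleFamily m ξ η j ω := rfl
    rw [this, ← MeasurableSpace.comap_comp]
    exact MeasurableSpace.comap_mono (measurable_pi_apply j).comap_le
  refine indep_sup_left hs.measurable_init.comap_le (iSup₂_le fun i _ => hle i) (hle j) ?_ ?_
  · exact indep_of_indep_of_le_right hs.indep_init
      (sup_le (iSup₂_le fun i _ => hall i) (hall j))
  · have := indep_iSup_of_disjoint hle hs.indep_samples (Set.disjoint_singleton_right.2 hj)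
    simpa only [Set.mem_singleton_iff, iSup_iSup_eq_left] using this

theorem IsSampling.indepFun {μ : Measure Ω} [IsProbabilityMeasure μ] {P : Measure Ξ}
    (hs : IsSampling μ P m ξ η X₀) {S : Set (SampleIdx m)} {j : SampleIdx m} (hj : j ∉ S)
    {E : Type*} [MeasurableSpace E] {f : Ω → E} (hf : Measurable[info m ξ η X₀ S] f) :
    IndepFun f (sampleFamily m ξ η j) μ :=
  indep_of_indep_of_le_left (hs.indep_info hj) hf.comap_le

/-- The filtration of the algorithm: the information available after `n` steps. -/
def pastFiltration {μ : Measure Ω} {P : Measure Ξ} (hs : IsSampling μ P m ξ η X₀) :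
    Filtration ℕ mΩ where
  seq n := info m ξ η X₀ (pastIdx m n)
  mono' _ _ h := info_mono fun _ hj => le_trans hj h
  le' _ := hs.info_le _

theorem pastIdx_subset_halfIdx (n : ℕ) : pastIdx m n ⊆ halfIdx m n := fun _ h => Or.inl h

theorem halfIdx_subset_pastIdx (n : ℕ) : halfIdx m n ⊆ pastIdx m (n + 1) := by
  rintro j (h | h)
  · exact Nat.le_succ_of_le h
  · exact h.2.le

end Info

/-! ### The intermediate iterates -/

theorem measurable_batchMean {d : ℕ} {Ω Ξ : Type*} [MeasurableSpace Ω] [MeasurableSpace Ξ]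
    {F : Vec d → Ξ → Vec d} (hF : Measurable (Function.uncurry F)) {M : ℕ} {ζ : ℕ → Ω → Ξ}
    (hζ : ∀ i ∈ Finset.Icc 1 M, Measurable (ζ i)) {V : Ω → Vec d} (hV : Measurable V) :
    Measurable fun ω => batchMean F M (fun i => ζ i ω) (V ω) :=
  (Finset.measurable_fun_sum _ fun i hi => hF.comp (hV.prodMk (hζ i hi))).const_smul (1 / (M : ℝ))

section Iterates

variable {d : ℕ} {Ω Ξ : Type*}

/-- The estimator `A_{n+1}` of `T(X_n)`. -/
noncomputable def estA (K : Set (Vec d)) (F : Vec d → Ξ → Vec d) (α : ℕ → ℝ) (m : ℕ → ℕ)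
    (ξ η : ℕ → ℕ → Ω → Ξ) (X₀ : Ω → Vec d) (n : ℕ) (ω : Ω) : Vec d :=
  batchMean F (m (n + 1)) (fun i => ξ (n + 1) i ω) (iterate K F α m ξ η X₀ n ω)

/-- The forward-backward point `Y_n`. -/
noncomputable def midpoint (K : Set (Vec d)) (F : Vec d → Ξ → Vec d) (α : ℕ → ℝ) (m : ℕ → ℕ)
    (ξ η : ℕ → ℕ → Ω → Ξ) (X₀ : Ω → Vec d) (n : ℕ) (ω : Ω) : Vec d :=
  proj K (iterate K F α m ξ η X₀ n ω - α n • estA K F α m ξ η X₀ n ω)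

/-- The estimator `B_{n+1}` of `T(Y_n)`. -/
noncomputable def estB (K : Set (Vec d)) (F : Vec d → Ξ → Vec d) (α : ℕ → ℝ) (m : ℕ → ℕ)
    (ξ η : ℕ → ℕ → Ω → Ξ) (X₀ : Ω → Vec d) (n : ℕ) (ω : Ω) : Vec d :=
  batchMean F (m (n + 1)) (fun i => η (n + 1) i ω) (midpoint K F α m ξ η X₀ n ω)

theorem iterate_succ (K : Set (Vec d)) (F : Vec d → Ξ → Vec d) (α : ℕ → ℝ) (m : ℕ → ℕ)
    (ξ η : ℕ → ℕ → Ω → Ξ) (X₀ : Ω → Vec d) (n : ℕ) (ω : Ω) :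
    iterate K F α m ξ η X₀ (n + 1) ω = midpoint K F α m ξ η X₀ n ω
      + α n • (estA K F α m ξ η X₀ n ω - estB K F α m ξ η X₀ n ω) :=
  rfl

variable [MeasurableSpace Ξ]
  {K : Set (Vec d)} {F : Vec d → Ξ → Vec d} {α : ℕ → ℝ} {m : ℕ → ℕ} {ξ η : ℕ → ℕ → Ω → Ξ}
  {X₀ : Ω → Vec d}

theorem measurable_info_estA (hF : Measurable (Function.uncurry F)) {n : ℕ}
    (h : Measurable[info m ξ η X₀ (pastIdx m n)] (iterate K F α m ξ η X₀ n)) :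
    Measurable[info m ξ η X₀ (halfIdx m n)] (estA K F α m ξ η X₀ n) :=
  @measurable_batchMean _ _ _ (info m ξ η X₀ (halfIdx m n)) _ _ hF _ _
    (fun _ hi => measurable_info_sample (j := mkIdx m n true hi) (Or.inr ⟨rfl, rfl⟩)) _
    (h.mono (info_mono (pastIdx_subset_halfIdx n)) le_rfl)

theorem measurable_info_midpoint (hF : Measurable (Function.uncurry F))
    (hK : Measurable (proj K)) {n : ℕ}
    (h : Measurable[info m ξ η X₀ (pastIdx m n)] (iterate K F α m ξ η X₀ n)) :
    Measurable[info m ξ η X₀ (halfIdx m n)] (midpoint K F α m ξ η X₀ n) :=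
  hK.comp ((h.mono (info_mono (pastIdx_subset_halfIdx n)) le_rfl).sub
    ((measurable_info_estA hF h).const_smul (α n)))

theorem measurable_info_estB (hF : Measurable (Function.uncurry F)) {n : ℕ}
    (h : Measurable[info m ξ η X₀ (halfIdx m n)] (midpoint K F α m ξ η X₀ n)) :
    Measurable[info m ξ η X₀ (pastIdx m (n + 1))] (estB K F α m ξ η X₀ n) :=
  @measurable_batchMean _ _ _ (info m ξ η X₀ (pastIdx m (n + 1))) _ _ hF _ _
    (fun _ hi => measurable_info_sample (j := mkIdx m n false hi) (le_refl (n + 1))) _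
    (h.mono (info_mono (halfIdx_subset_pastIdx n)) le_rfl)

theorem measurable_info_iterate (hF : Measurable (Function.uncurry F)) (hK : Measurable (proj K))
    (n : ℕ) : Measurable[info m ξ η X₀ (pastIdx m n)] (iterate K F α m ξ η X₀ n) := by
  induction n with
  | zero => exact measurable_info_init _
  | succ n ih =>
    have hmono := info_mono (ξ := ξ) (η := η) (X₀ := X₀) (halfIdx_subset_pastIdx (m := m) n)
    have hY := measurable_info_midpoint hF hK ih
    exact (hY.mono hmono le_rfl).add ((((measurable_info_estA hF ih).mono hmono le_rfl).sub
      (measurable_info_estB hF hY)).const_smul (α n))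

variable [mΩ : MeasurableSpace Ω] {μ : Measure Ω} [IsProbabilityMeasure μ] {P : Measure Ξ} [IsProbabilityMeasure P]

theorem memLp_estA_error (hF : Measurable (Function.uncurry F)) (hFint : ∀ x, Integrable (F x) P)
    (hT : Measurable (meanOp P F)) (hK : Measurable (proj K)) {p : Vec d} {c : ℝ} (hc : 0 ≤ c)
    (hvar : ∀ x, ∫⁻ z, ‖F x z - meanOp P F x‖ₑ ^ 2 ∂P ≤ ENNReal.ofReal (c * (1 + ‖x - p‖ ^ 2)))
    (hs : IsSampling μ P m ξ η X₀) (hm : ∀ n, 1 ≤ m (n + 1)) {n : ℕ}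
    (h : MemLp (fun ω => iterate K F α m ξ η X₀ n ω - p) 2 μ) :
    MemLp (fun ω => estA K F α m ξ η X₀ n ω - meanOp P F (iterate K F α m ξ η X₀ n ω)) 2 μ ∧
      ∫ ω, ‖estA K F α m ξ η X₀ n ω - meanOp P F (iterate K F α m ξ η X₀ n ω)‖ ^ 2 ∂μ
        ≤ c / m (n + 1) * (1 + ∫ ω, ‖iterate K F α m ξ η X₀ n ω - p‖ ^ 2 ∂μ) := by
  have hX := measurable_info_iterate (α := α) (m := m) (ξ := ξ) (η := η) (X₀ := X₀) hF hK n
  have hnot : ∀ i (hi : i ∈ Finset.Icc 1 (m (n + 1))), mkIdx m n true hi ∉ pastIdx m n :=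
    fun i hi => Nat.not_succ_le_self n
  refine memLp_batchError hF hFint hT hc hvar (hX.mono (hs.info_le _) le_rfl) h (hm n)
    (fun i hi => hs.measurable_sample (mkIdx m n true hi))
    (fun i hi => hs.law_sample (mkIdx m n true hi)) (fun i hi j hj hij => ?_)
    fun i hi => hs.indepFun (hnot i hi) hX
  have hnot' : mkIdx m n true hi ∉ insert (mkIdx m n true hj) (pastIdx m n) := by
    rintro (h | h)
    · exact hij (congrArg (fun k : SampleIdx m => k.2.1.2) h)
    · exact hnot i hi h
  exact hs.indepFun hnot' ((hX.mono (info_mono (Set.subset_insert _ _)) le_rfl).prodMk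
    (measurable_info_sample (Set.mem_insert (mkIdx m n true hj) _)))

theorem mkIdx_false_notMem_halfIdx {n i : ℕ} (hi : i ∈ Finset.Icc 1 (m (n + 1))) :
    mkIdx m n false hi ∉ halfIdx m n := by
  rintro (h | h)
  · exact Nat.not_succ_le_self n h
  · exact Bool.false_ne_true h.1

theorem memLp_estB_error (hF : Measurable (Function.uncurry F)) (hFint : ∀ x, Integrable (F x) P)
    (hT : Measurable (meanOp P F)) (hK : Measurable (proj K)) {p : Vec d} {c : ℝ} (hc : 0 ≤ c)
    (hvar : ∀ x, ∫⁻ z, ‖F x z - meanOp P F x‖ₑ ^ 2 ∂P ≤ ENNReal.ofReal (c * (1 + ‖x - p‖ ^ 2)))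
    (hs : IsSampling μ P m ξ η X₀) (hm : ∀ n, 1 ≤ m (n + 1)) {n : ℕ}
    (h : MemLp (fun ω => midpoint K F α m ξ η X₀ n ω - p) 2 μ) :
    MemLp (fun ω => estB K F α m ξ η X₀ n ω - meanOp P F (midpoint K F α m ξ η X₀ n ω)) 2 μ ∧
      ∫ ω, ‖estB K F α m ξ η X₀ n ω - meanOp P F (midpoint K F α m ξ η X₀ n ω)‖ ^ 2 ∂μ
        ≤ c / m (n + 1) * (1 + ∫ ω, ‖midpoint K F α m ξ η X₀ n ω - p‖ ^ 2 ∂μ) := by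
  have hY := measurable_info_midpoint hF hK
    (measurable_info_iterate (α := α) (m := m) (ξ := ξ) (η := η) (X₀ := X₀) hF hK n)
  refine memLp_batchError hF hFint hT hc hvar (hY.mono (hs.info_le _) le_rfl) h (hm n)
    (fun i hi => hs.measurable_sample (mkIdx m n false hi))
    (fun i hi => hs.law_sample (mkIdx m n false hi)) (fun i hi j hj hij => ?_)
    fun i hi => hs.indepFun (mkIdx_false_notMem_halfIdx hi) hY
  have hnot' : mkIdx m n false hi ∉ insert (mkIdx m n false hj) (halfIdx m n) := by
    rintro (h | h)
    · exact hij (congrArg (fun k : SampleIdx m => k.2.1.2) h)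
    · exact mkIdx_false_notMem_halfIdx hi h
  exact hs.indepFun hnot' ((hY.mono (info_mono (Set.subset_insert _ _)) le_rfl).prodMk
    (measurable_info_sample (Set.mem_insert (mkIdx m n false hj) _)))

/-- The error of the estimator at `Y_n`, tested against `Y_n - p`, is a martingale difference. -/
theorem setIntegral_inner_estB_error_eq_zero (hF : Measurable (Function.uncurry F))
    (hFint : ∀ x, Integrable (F x) P) (hT : Measurable (meanOp P F)) (hK : Measurable (proj K))
    {p : Vec d} {c : ℝ} (hc : 0 ≤ c)
    (hvar : ∀ x, ∫⁻ z, ‖F x z - meanOp P F x‖ₑ ^ 2 ∂P ≤ ENNReal.ofReal (c * (1 + ‖x - p‖ ^ 2)))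
    (hs : IsSampling μ P m ξ η X₀) (hm : ∀ n, 1 ≤ m (n + 1)) {n : ℕ}
    (h : MemLp (fun ω => midpoint K F α m ξ η X₀ n ω - p) 2 μ) {s : Set Ω}
    (hsm : MeasurableSet[info m ξ η X₀ (pastIdx m n)] s) :
    ∫ ω in s, inner ℝ (estB K F α m ξ η X₀ n ω - meanOp P F (midpoint K F α m ξ η X₀ n ω))
      (midpoint K F α m ξ η X₀ n ω - p) ∂μ = 0 := by
  have hY := measurable_info_midpoint hF hK
    (measurable_info_iterate (α := α) (m := m) (ξ := ξ) (η := η) (X₀ := X₀) hF hK n)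
  have hsm' := info_mono (pastIdx_subset_halfIdx n) _ hsm
  have hsΩ := hs.info_le _ _ hsm
  set Q : Ω → Vec d := s.indicator fun ω => midpoint K F α m ξ η X₀ n ω - p with hQ
  have hQm : Measurable[info m ξ η X₀ (halfIdx m n)] Q :=
    (hY.sub measurable_const).indicator hsm'
  rw [← integral_indicator hsΩ, ← integral_inner_batchError_eq_zero hF hFint hT hc hvar
    (hY.mono (hs.info_le _) le_rfl) h (hQm.mono (hs.info_le _) le_rfl) (h.indicator hsΩ) (hm n)
    (ζ := fun i => η (n + 1) i) (fun i hi => hs.measurable_sample (mkIdx m n false hi))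
    (fun i hi => hs.law_sample (mkIdx m n false hi))
    fun i hi => hs.indepFun (mkIdx_false_notMem_halfIdx hi) (hY.prodMk hQm)]
  refine integral_congr_ae (Eventually.of_forall fun ω => ?_)
  by_cases hω : ω ∈ s <;> simp [hQ, hω, estB]

end Iterates

/-! ### Square-integrable starting points -/

section L2

variable {d : ℕ} {Ω Ξ : Type*} [mΩ : MeasurableSpace Ω] [MeasurableSpace Ξ]
  {μ : Measure Ω} {P : Measure Ξ}
  {K : Set (Vec d)} {F : Vec d → Ξ → Vec d} {L : ℝ≥0} {α : ℕ → ℝ} {m : ℕ → ℕ}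
  {ξ η : ℕ → ℕ → Ω → Ξ} {X₀ : Ω → Vec d}

theorem memLp_midpoint_sub (hne : K.Nonempty) (hc : IsClosed K) (hconv : Convex ℝ K)
    (hLip : LipschitzWith L (meanOp P F)) (hF : Measurable (Function.uncurry F))
    {p : Vec d} (hp : p ∈ solutionSet (meanOp P F) K) (hα : ∀ n, 0 ≤ α n)
    (hs : IsSampling μ P m ξ η X₀) {n : ℕ}
    (h : MemLp (fun ω => iterate K F α m ξ η X₀ n ω - p) 2 μ)
    (hA : MemLp (fun ω => estA K F α m ξ η X₀ n ω
      - meanOp P F (iterate K F α m ξ η X₀ n ω)) 2 μ) :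
    MemLp (fun ω => midpoint K F α m ξ η X₀ n ω - p) 2 μ := by
  have hK := (lipschitzWith_proj hne hc hconv).continuous.measurable
  have hY := (measurable_info_midpoint (α := α) (m := m) (ξ := ξ) (η := η) (X₀ := X₀) hF hK
    (measurable_info_iterate hF hK n)).mono (hs.info_le _) le_rfl
  refine ((h.norm.const_mul (1 + α n * L)).add (hA.norm.const_mul (α n))).of_le
    (hY.sub measurable_const).aestronglyMeasurable (Eventually.of_forall fun ω => ?_)
  exact (norm_midpoint_sub_le hne hc hconv hLip hp (hα n) _ _).trans (le_abs_self _)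

variable [IsProbabilityMeasure μ] [IsProbabilityMeasure P]

theorem memLp_iterate_sub (hne : K.Nonempty) (hc : IsClosed K) (hconv : Convex ℝ K)
    (hLip : LipschitzWith L (meanOp P F)) (hF : Measurable (Function.uncurry F))
    (hFint : ∀ x, Integrable (F x) P)
    {p : Vec d} (hp : p ∈ solutionSet (meanOp P F) K) {c : ℝ} (hc0 : 0 ≤ c)
    (hvar : ∀ x, ∫⁻ z, ‖F x z - meanOp P F x‖ₑ ^ 2 ∂P ≤ ENNReal.ofReal (c * (1 + ‖x - p‖ ^ 2)))
    (hα : ∀ n, 0 ≤ α n) (hm : ∀ n, 1 ≤ m (n + 1)) (hs : IsSampling μ P m ξ η X₀)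
    (hX₀ : MemLp X₀ 2 μ) (n : ℕ) : MemLp (fun ω => iterate K F α m ξ η X₀ n ω - p) 2 μ := by
  have hT := hLip.continuous.measurable
  have hK := (lipschitzWith_proj hne hc hconv).continuous.measurable
  induction n with
  | zero => exact hX₀.sub (memLp_const p)
  | succ n ih =>
    have hA := (memLp_estA_error hF hFint hT hK hc0 hvar hs hm ih).1
    have hY := memLp_midpoint_sub hne hc hconv hLip hF hp hα hs ih hA
    have hB := (memLp_estB_error hF hFint hT hK hc0 hvar hs hm hY).1
    have hXY := ih.sub hY
    have hTXY : MemLp (fun ω => meanOp P F (iterate K F α m ξ η X₀ n ω)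
        - meanOp P F (midpoint K F α m ξ η X₀ n ω)) 2 μ := by
      have hXm := (measurable_info_iterate (α := α) (m := m) (ξ := ξ) (η := η) (X₀ := X₀)
        hF hK n).mono (hs.info_le _) le_rfl
      have hYm := (measurable_info_midpoint (α := α) (m := m) (ξ := ξ) (η := η) (X₀ := X₀) hF hK
        (measurable_info_iterate hF hK n)).mono (hs.info_le _) le_rfl
      refine hXY.of_le_mul (c := L) ((hT.comp hXm).sub (hT.comp hYm)).aestronglyMeasurable
        (Eventually.of_forall fun ω => ?_)
      have := hLip.dist_le_mul (iterate K F α m ξ η X₀ n ω) (midpoint K F α m ξ η X₀ n ω)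
      simpa [dist_eq_norm] using this
    refine (hY.add (((hTXY.add hA).sub hB).const_smul (α n))).ae_eq
      (Eventually.of_forall fun ω => ?_)
    simp only [Pi.add_apply, Pi.sub_apply, Pi.smul_apply, iterate_succ]
    module

/-- Mean-square analysis of the Fejér inequality at one solution `p`: the increments
`X_n - Y_n` and the errors of `A_{n+1}` are square-summable in mean, and the distance of the
iterates to `p` converges almost surely. -/
theorem summable_and_ae_tendsto_norm_sub (hne : K.Nonempty) (hc : IsClosed K)
    (hconv : Convex ℝ K) (hLip : LipschitzWith L (meanOp P F))
    (hmono : PseudoMonotone (meanOp P F)) (hF : Measurable (Function.uncurry F))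
    (hFint : ∀ x, Integrable (F x) P)
    {p : Vec d} (hp : p ∈ solutionSet (meanOp P F) K) {c : ℝ} (hc0 : 0 ≤ c)
    (hvar : ∀ x, ∫⁻ z, ‖F x z - meanOp P F x‖ₑ ^ 2 ∂P ≤ ENNReal.ofReal (c * (1 + ‖x - p‖ ^ 2)))
    (hα : ∀ n, 0 ≤ α n) {αmax : ℝ} (hαmax : ∀ n, α (n + 1) ≤ αmax)
    (hαL : 2 * αmax ^ 2 * (L : ℝ) ^ 2 < 1) (hm : ∀ n, 1 ≤ m (n + 1))
    (hbatch : Summable fun n : ℕ => 1 / (m (n + 1) : ℝ)) (hs : IsSampling μ P m ξ η X₀)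
    (hX₀ : MemLp X₀ 2 μ) :
    (Summable fun n =>
      ∫ ω, ‖iterate K F α m ξ η X₀ n ω - midpoint K F α m ξ η X₀ n ω‖ ^ 2 ∂μ) ∧
    (Summable fun n => ∫ ω, ‖estA K F α m ξ η X₀ n ω
      - meanOp P F (iterate K F α m ξ η X₀ n ω)‖ ^ 2 ∂μ) ∧
    ∀ᵐ ω ∂μ, ∃ l, Tendsto (fun n => ‖iterate K F α m ξ η X₀ n ω - p‖) atTop (𝓝 l) := by
  have hT := hLip.continuous.measurable
  have hK := (lipschitzWith_proj hne hc hconv).continuous.measurable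
  set X := iterate K F α m ξ η X₀ with hX
  set Y := midpoint K F α m ξ η X₀ with hY
  set W : ℕ → Ω → Vec d := fun n ω => estA K F α m ξ η X₀ n ω - meanOp P F (X n ω) with hW
  set Z : ℕ → Ω → Vec d := fun n ω => estB K F α m ξ η X₀ n ω - meanOp P F (Y n ω) with hZ
  have hXm : ∀ n, Measurable[info m ξ η X₀ (pastIdx m n)] (X n) := measurable_info_iterate hF hK
  have hYm : ∀ n, Measurable[info m ξ η X₀ (halfIdx m n)] (Y n) := fun n =>
    measurable_info_midpoint hF hK (hXm n)
  have hX2 : ∀ n, MemLp (fun ω => X n ω - p) 2 μ :=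
    memLp_iterate_sub hne hc hconv hLip hF hFint hp hc0 hvar hα hm hs hX₀
  have hW2 : ∀ n, MemLp (W n) 2 μ ∧ ∫ ω, ‖W n ω‖ ^ 2 ∂μ
      ≤ c / m (n + 1) * (1 + ∫ ω, ‖X n ω - p‖ ^ 2 ∂μ) := fun n =>
    memLp_estA_error hF hFint hT hK hc0 hvar hs hm (hX2 n)
  have hY2 : ∀ n, MemLp (fun ω => Y n ω - p) 2 μ := fun n =>
    memLp_midpoint_sub hne hc hconv hLip hF hp hα hs (hX2 n) (hW2 n).1
  have hZ2 : ∀ n, MemLp (Z n) 2 μ ∧ ∫ ω, ‖Z n ω‖ ^ 2 ∂μ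
      ≤ c / m (n + 1) * (1 + ∫ ω, ‖Y n ω - p‖ ^ 2 ∂μ) := fun n =>
    memLp_estB_error hF hFint hT hK hc0 hvar hs hm (hY2 n)
  have hXY2 : ∀ n, MemLp (fun ω => X n ω - Y n ω) 2 μ := fun n =>
    ((hX2 n).sub (hY2 n)).ae_eq (Eventually.of_forall fun ω => by simp)
  set u : ℕ → ℝ := fun n => ∫ ω, ‖X n ω - p‖ ^ 2 ∂μ with hu
  set q : ℕ → ℝ := fun n => ∫ ω, ‖X n ω - Y n ω‖ ^ 2 ∂μ with hq
  set w : ℕ → ℝ := fun n => ∫ ω, ‖W n ω‖ ^ 2 ∂μ with hw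
  set z : ℕ → ℝ := fun n => ∫ ω, ‖Z n ω‖ ^ 2 ∂μ with hz
  have hu0 : ∀ n, 0 ≤ u n := fun n => integral_nonneg fun ω => by positivity
  have hq0 : ∀ n, 0 ≤ q n := fun n => integral_nonneg fun ω => by positivity
  have hw0 : ∀ n, 0 ≤ w n := fun n => integral_nonneg fun ω => by positivity
  have hz0 : ∀ n, 0 ≤ z n := fun n => integral_nonneg fun ω => by positivity
  -- The first step size is not subject to the bound `αmax`, hence the maximum.
  set a : ℝ := max (α 0) αmax with ha
  have hαa : ∀ n, α n ≤ a := fun n => by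
    cases n with
    | zero => exact le_max_left _ _
    | succ n => exact (hαmax n).trans (le_max_right _ _)
  have ha0 : 0 ≤ a := (hα 0).trans (hαa 0)
  set C₁ : ℝ := 2 * (1 + a * L) ^ 2 + 2 * a ^ 2 * c with hC₁
  have hL0 : (0 : ℝ) ≤ L := L.2
  have hC₁0 : 0 ≤ C₁ := by positivity
  have hm1 : ∀ n, (1 : ℝ) ≤ m (n + 1) := fun n => by exact_mod_cast hm n
  have hYb : ∀ n, ∫ ω, ‖Y n ω - p‖ ^ 2 ∂μ ≤ C₁ * (1 + u n) := by
    intro n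
    have hpt : ∀ ω, ‖Y n ω - p‖ ^ 2
        ≤ 2 * (1 + a * L) ^ 2 * ‖X n ω - p‖ ^ 2 + 2 * a ^ 2 * ‖W n ω‖ ^ 2 := by
      intro ω
      have h1 : ‖Y n ω - p‖ ≤ (1 + a * L) * ‖X n ω - p‖ + a * ‖W n ω‖ := by
        refine (norm_midpoint_sub_le hne hc hconv hLip hp (hα n) _ _).trans ?_
        have := hαa n
        gcongr
      have h2 := pow_le_pow_left₀ (norm_nonneg _) h1 2
      nlinarith [sq_nonneg ((1 + a * L) * ‖X n ω - p‖ - a * ‖W n ω‖)]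
    have h3 : ∫ ω, ‖Y n ω - p‖ ^ 2 ∂μ ≤ 2 * (1 + a * L) ^ 2 * u n + 2 * a ^ 2 * w n := by
      have i1 := (integrable_norm_sq_of_memLp_two (hX2 n)).const_mul (2 * (1 + a * (L : ℝ)) ^ 2)
      have i2 := (integrable_norm_sq_of_memLp_two (hW2 n).1).const_mul (2 * a ^ 2)
      rw [hu, hw, ← integral_const_mul, ← integral_const_mul, ← integral_add i1 i2]
      exact integral_mono (integrable_norm_sq_of_memLp_two (hY2 n)) (i1.add i2) hpt
    have h4 : w n ≤ c * (1 + u n) := by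
      refine (hW2 n).2.trans (mul_le_mul_of_nonneg_right ?_ (by linarith [hu0 n]))
      exact div_le_self hc0 (hm1 n)
    have h5 := mul_le_mul_of_nonneg_left h4 (show (0 : ℝ) ≤ 2 * a ^ 2 by positivity)
    have h6 : (0 : ℝ) ≤ 2 * (1 + a * L) ^ 2 := by positivity
    nlinarith
  set C₂ : ℝ := c * (2 + C₁) with hC₂
  have hC₂0 : 0 ≤ C₂ := by positivity
  have hwz : ∀ n, w n + z n ≤ C₂ * (1 / (m (n + 1) : ℝ)) * (1 + u n) := by
    intro n
    have h1 := (hW2 n).2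
    have h2 : z n ≤ c / m (n + 1) * ((1 + C₁) * (1 + u n)) := by
      refine (hZ2 n).2.trans (mul_le_mul_of_nonneg_left ?_ (by positivity))
      linarith [hYb n, hu0 n]
    calc w n + z n ≤ c / m (n + 1) * (1 + u n) + c / m (n + 1) * ((1 + C₁) * (1 + u n)) :=
          add_le_add h1 h2
      _ = _ := by rw [hC₂]; ring
  -- For `n = 0` the factor of `‖X - Y‖²` may have the wrong sign; only the size of `R` matters.
  set R : ℕ → Ω → ℝ := fun n ω => 4 * α n ^ 2 * (‖W n ω‖ ^ 2 + ‖Z n ω‖ ^ 2)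
    - (1 - 2 * α n ^ 2 * (L : ℝ) ^ 2) * ‖X n ω - Y n ω‖ ^ 2 with hR
  set N : ℕ → Ω → ℝ := fun n ω => 2 * α n * inner ℝ (Z n ω) (Y n ω - p) with hN
  have hfej : ∀ n ω, ‖X (n + 1) ω - p‖ ^ 2 ≤ ‖X n ω - p‖ ^ 2 - N n ω + R n ω := fun n ω =>
    norm_step_sub_sq_le hne hc hconv hLip hmono hp (hα n) rfl
  have iX := fun n => integrable_norm_sq_of_memLp_two (hX2 n)
  have iW := fun n => integrable_norm_sq_of_memLp_two (hW2 n).1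
  have iZ := fun n => integrable_norm_sq_of_memLp_two (hZ2 n).1
  have iXY := fun n => integrable_norm_sq_of_memLp_two (hXY2 n)
  have iWZ : ∀ n, Integrable (fun ω => ‖W n ω‖ ^ 2 + ‖Z n ω‖ ^ 2) μ := fun n =>
    (iW n).add (iZ n)
  have iN : ∀ n, Integrable (N n) μ := fun n =>
    (integrable_inner_of_memLp_two (hZ2 n).1 (hY2 n)).const_mul _
  have iR : ∀ n, Integrable (R n) μ := fun n =>
    ((iWZ n).const_mul _).sub ((iXY n).const_mul _)
  have hN0 : ∀ n s, MeasurableSet[info m ξ η X₀ (pastIdx m n)] s → ∫ ω in s, N n ω ∂μ = 0 :=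
    fun n s hsm => by
      rw [hN, integral_const_mul, setIntegral_inner_estB_error_eq_zero hF hFint hT hK hc0 hvar hs
        hm (hY2 n) hsm, mul_zero]
  have hER : ∀ n, ∫ ω, R n ω ∂μ
      = 4 * α n ^ 2 * (w n + z n) - (1 - 2 * α n ^ 2 * (L : ℝ) ^ 2) * q n := fun n => by
    simp only [hR]
    rw [integral_sub ((iWZ n).const_mul _) ((iXY n).const_mul _),
      integral_const_mul, integral_const_mul, integral_add (iW n) (iZ n)]
  have hrec : ∀ n, u (n + 1) + (1 - 2 * α n ^ 2 * (L : ℝ) ^ 2) * q n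
      ≤ u n + 4 * α n ^ 2 * (w n + z n) := by
    intro n
    have h1 : u (n + 1) ≤ ∫ ω, (‖X n ω - p‖ ^ 2 - N n ω + R n ω) ∂μ :=
      integral_mono (iX (n + 1)) (((iX n).sub (iN n)).add (iR n)) (hfej n)
    have h2 := hN0 n Set.univ MeasurableSet.univ
    rw [setIntegral_univ] at h2
    have i1 : Integrable (fun ω => ‖X n ω - p‖ ^ 2 - N n ω) μ := (iX n).sub (iN n)
    rw [integral_add i1 (iR n), integral_sub (iX n) (iN n), h2, hER] at h1
    linarith
  set ρ : ℝ := 1 - 2 * αmax ^ 2 * (L : ℝ) ^ 2 with hρ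
  have hρ0 : 0 < ρ := by linarith
  have hbs : Summable fun n : ℕ => 4 * a ^ 2 * C₂ * (1 / (m (n + 1 + 1) : ℝ)) :=
    ((summable_nat_add_iff 1).2 hbatch).mul_left _
  -- The recursion starts at `n = 1`, where the step sizes are small.
  obtain ⟨⟨C, hC⟩, hsum⟩ := bddAbove_and_summable_of_recursion
    (u := fun n => u (n + 1)) (v := fun n => ρ * q (n + 1)) (fun n => hu0 _)
    (fun n => mul_nonneg hρ0.le (hq0 _)) (fun n => by positivity) hbs (fun n => by
      have h1 := hrec (n + 1)
      have h2 : α (n + 1) ^ 2 ≤ αmax ^ 2 := pow_le_pow_left₀ (hα _) (hαmax n) 2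
      have h3 : α (n + 1) ^ 2 ≤ a ^ 2 := pow_le_pow_left₀ (hα _) (hαa _) 2
      have h4 : ρ * q (n + 1) ≤ (1 - 2 * α (n + 1) ^ 2 * (L : ℝ) ^ 2) * q (n + 1) := by
        refine mul_le_mul_of_nonneg_right ?_ (hq0 _)
        have := mul_le_mul_of_nonneg_right h2 (sq_nonneg (L : ℝ))
        rw [hρ]
        linarith
      have h5 : 4 * α (n + 1) ^ 2 * (w (n + 1) + z (n + 1)) ≤
          4 * a ^ 2 * (C₂ * (1 / (m (n + 1 + 1) : ℝ)) * (1 + u (n + 1))) :=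
        mul_le_mul (by linarith) (hwz (n + 1)) (add_nonneg (hw0 _) (hz0 _)) (by positivity)
      calc u (n + 1 + 1) + ρ * q (n + 1)
          ≤ u (n + 1) + 4 * a ^ 2 * (C₂ * (1 / (m (n + 1 + 1) : ℝ)) * (1 + u (n + 1))) := by
            linarith
        _ = _ := by ring)
  have hqs : Summable q := by
    rw [← summable_nat_add_iff 1]
    simpa [hρ0.ne'] using hsum.mul_left ρ⁻¹
  set C' : ℝ := max (u 0) C with hC'
  have huC : ∀ n, u n ≤ C' := fun n => by
    cases n with
    | zero => exact le_max_left _ _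
    | succ n => exact (hC n).trans (le_max_right _ _)
  have hwzs : Summable fun n => w n + z n := by
    refine Summable.of_nonneg_of_le (fun n => add_nonneg (hw0 n) (hz0 n)) (fun n => ?_)
      ((hbatch.mul_left C₂).mul_right (1 + C'))
    exact (hwz n).trans (mul_le_mul_of_nonneg_left (by linarith [huC n]) (by positivity))
  refine ⟨hqs, Summable.of_nonneg_of_le hw0 (fun n => by linarith [hz0 n]) hwzs, ?_⟩
  have hRs : Summable fun n => ∫ ω, ‖R n ω‖ ∂μ := by
    refine Summable.of_nonneg_of_le (fun n => integral_nonneg fun ω => norm_nonneg _)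
      (fun n => ?_) ((hwzs.mul_left (4 * a ^ 2)).add (hqs.mul_left (1 + 2 * a ^ 2 * (L : ℝ) ^ 2)))
    have i1 := (iWZ n).const_mul (4 * a ^ 2)
    have i2 := (iXY n).const_mul (1 + 2 * a ^ 2 * (L : ℝ) ^ 2)
    have hle : ∀ ω, ‖R n ω‖ ≤ 4 * a ^ 2 * (‖W n ω‖ ^ 2 + ‖Z n ω‖ ^ 2)
        + (1 + 2 * a ^ 2 * (L : ℝ) ^ 2) * ‖X n ω - Y n ω‖ ^ 2 := by
      intro ω
      have h3 : α n ^ 2 ≤ a ^ 2 := pow_le_pow_left₀ (hα _) (hαa _) 2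
      have h4 : α n ^ 2 * (L : ℝ) ^ 2 ≤ a ^ 2 * (L : ℝ) ^ 2 :=
        mul_le_mul_of_nonneg_right h3 (sq_nonneg _)
      refine (norm_sub_le _ _).trans (add_le_add ?_ ?_)
      · rw [Real.norm_of_nonneg (by positivity)]
        gcongr
      · rw [norm_mul, Real.norm_of_nonneg (sq_nonneg ‖X n ω - Y n ω‖)]
        refine mul_le_mul_of_nonneg_right ?_ (sq_nonneg _)
        have h5 : 0 ≤ α n ^ 2 * (L : ℝ) ^ 2 := by positivity
        rw [Real.norm_eq_abs, abs_le]
        constructor <;> linarith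
    refine (integral_mono (iR n).norm (i1.add i2) hle).trans (le_of_eq ?_)
    simp only [Pi.add_apply]
    rw [integral_add i1 i2, integral_const_mul, integral_const_mul, integral_add (iW n) (iZ n)]
  have hpm := pastIdx_subset_halfIdx (m := m)
  have hhm := halfIdx_subset_pastIdx (m := m)
  have hsq : Measurable fun x : Vec d => ‖x‖ ^ 2 := by fun_prop
  have hRm : ∀ n, Measurable[info m ξ η X₀ (pastIdx m (n + 1))] (R n) := by
    intro n
    have mX := (hXm n).mono (info_mono ((hpm n).trans (hhm n))) le_rfl
    have mY := (hYm n).mono (info_mono (hhm n)) le_rfl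
    have mW : Measurable[info m ξ η X₀ (pastIdx m (n + 1))] (W n) :=
      ((measurable_info_estA hF (hXm n)).mono (info_mono (hhm n)) le_rfl).sub (hT.comp mX)
    have mZ : Measurable[info m ξ η X₀ (pastIdx m (n + 1))] (Z n) :=
      (measurable_info_estB hF (hYm n)).sub (hT.comp mY)
    exact (((hsq.comp mW).add (hsq.comp mZ)).const_mul _).sub
      ((hsq.comp (mX.sub mY)).const_mul _)
  have hconv := ae_exists_tendsto_of_almost_supermartingale (pastFiltration hs)
    (V := fun n ω => ‖X n ω - p‖ ^ 2) (fun n ω => by positivity)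
    (fun n => hsq.comp ((hXm n).sub measurable_const)) iX huC hRm iR hRs iN hN0 hfej
  filter_upwards [hconv] with ω ⟨l, hl⟩
  exact ⟨√l, ((Real.continuous_sqrt.tendsto l).comp hl).congr fun n =>
    Real.sqrt_sq (norm_nonneg _)⟩

end L2

/-! ### Convergence -/

section Convergence

variable {d : ℕ} {Ω Ξ : Type*} [mΩ : MeasurableSpace Ω] [MeasurableSpace Ξ]
  {μ : Measure Ω} [IsProbabilityMeasure μ] {P : Measure Ξ} [IsProbabilityMeasure P]
  {K : Set (Vec d)} {F : Vec d → Ξ → Vec d} {L : ℝ≥0} {α : ℕ → ℝ} {m : ℕ → ℕ}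
  {ξ η : ℕ → ℕ → Ω → Ξ} {X₀ : Ω → Vec d}

/-- Both claims for a jointly measurable map and a square-integrable starting point. Integrability
and the limit of the squared residual follow from its summability in mean. -/
theorem converges_of_memLp (hsol : (solutionSet (meanOp P F) K).Nonempty) (hne : K.Nonempty)
    (hc : IsClosed K) (hconv : Convex ℝ K) (hLip : LipschitzWith L (meanOp P F))
    (hmono : PseudoMonotone (meanOp P F)) (hF : Measurable (Function.uncurry F))
    (hFint : ∀ x, Integrable (F x) P)
    (hvar : ∀ p ∈ solutionSet (meanOp P F) K, ∃ c : ℝ, 0 ≤ c ∧ ∀ x,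
      ∫⁻ z, ‖F x z - meanOp P F x‖ₑ ^ 2 ∂P ≤ ENNReal.ofReal (c * (1 + ‖x - p‖ ^ 2)))
    {αmin αmax : ℝ} (hαmin : 0 < αmin) (hα : ∀ n, αmin ≤ α n) (hαmax : ∀ n, α (n + 1) ≤ αmax)
    (hαL : 2 * αmax ^ 2 * (L : ℝ) ^ 2 < 1) (hm : ∀ n, 1 ≤ m (n + 1))
    (hbatch : Summable fun n : ℕ => 1 / (m (n + 1) : ℝ)) (hs : IsSampling μ P m ξ η X₀)
    (hX₀ : MemLp X₀ 2 μ) :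
    (∀ᵐ ω ∂μ, ∃ q ∈ solutionSet (meanOp P F) K,
      Tendsto (fun n => iterate K F α m ξ η X₀ n ω) atTop (𝓝 q)) ∧
    (∀ n, Integrable
      (fun ω => residual K (meanOp P F) (α n) (iterate K F α m ξ η X₀ n ω) ^ 2) μ) ∧
    Tendsto (fun n => ∫ ω, residual K (meanOp P F) (α n) (iterate K F α m ξ η X₀ n ω) ^ 2 ∂μ)
      atTop (𝓝 0) := by
  have hα0 : ∀ n, 0 ≤ α n := fun n => hαmin.le.trans (hα n)
  have hT := hLip.continuous
  have hK := (lipschitzWith_proj hne hc hconv).continuous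
  set X := iterate K F α m ξ η X₀ with hX
  set Y := midpoint K F α m ξ η X₀ with hY
  set r : ℕ → Ω → ℝ := fun n ω => residual K (meanOp P F) (α n) (X n ω) with hr
  obtain ⟨p, hp⟩ := hsol
  obtain ⟨c, hc0, hvarp⟩ := hvar p hp
  have hX2 : ∀ n, MemLp (fun ω => X n ω - p) 2 μ :=
    memLp_iterate_sub hne hc hconv hLip hF hFint hp hc0 hvarp hα0 hm hs hX₀
  have hW2 := fun n => (memLp_estA_error hF hFint hT.measurable hK.measurable hc0 hvarp hs hm
    (hX2 n)).1
  have hY2 : ∀ n, MemLp (fun ω => Y n ω - p) 2 μ := fun n =>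
    memLp_midpoint_sub hne hc hconv hLip hF hp hα0 hs (hX2 n) (hW2 n)
  have hXY2 : ∀ n, MemLp (fun ω => X n ω - Y n ω) 2 μ := fun n =>
    ((hX2 n).sub (hY2 n)).ae_eq (Eventually.of_forall fun ω => by simp)
  obtain ⟨hq, hw, -⟩ := summable_and_ae_tendsto_norm_sub hne hc hconv hLip hmono hF hFint hp hc0
    hvarp hα0 hαmax hαL hm hbatch hs hX₀
  set a : ℝ := max (α 0) αmax with ha
  have hαa : ∀ n, α n ≤ a := fun n => by
    cases n with
    | zero => exact le_max_left _ _
    | succ n => exact (hαmax n).trans (le_max_right _ _)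
  have hrle : ∀ n ω, r n ω ^ 2 ≤ 2 * ‖X n ω - Y n ω‖ ^ 2
      + 2 * a ^ 2 * ‖estA K F α m ξ η X₀ n ω - meanOp P F (X n ω)‖ ^ 2 := by
    intro n ω
    have h1 : r n ω ≤ ‖X n ω - Y n ω‖
        + a * ‖estA K F α m ξ η X₀ n ω - meanOp P F (X n ω)‖ :=
      (residual_le hne hc hconv (meanOp P F) (hα0 n) (X n ω) (estA K F α m ξ η X₀ n ω)).trans
        (add_le_add le_rfl (mul_le_mul_of_nonneg_right (hαa n) (norm_nonneg _)))
    have h2 : r n ω ^ 2 ≤ _ := pow_le_pow_left₀ (norm_nonneg _) h1 2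
    nlinarith [sq_nonneg (‖X n ω - Y n ω‖
      - a * ‖estA K F α m ξ η X₀ n ω - meanOp P F (X n ω)‖)]
  have i1 := fun n => (integrable_norm_sq_of_memLp_two (hXY2 n)).const_mul 2
  have i2 := fun n => (integrable_norm_sq_of_memLp_two (hW2 n)).const_mul (2 * a ^ 2)
  have hXm : ∀ n, Measurable (X n) := fun n =>
    (measurable_info_iterate hF hK.measurable n).mono (hs.info_le _) le_rfl
  have hrint : ∀ n, Integrable (fun ω => r n ω ^ 2) μ := fun n => by
    refine ((i1 n).add (i2 n)).mono' ?_ (Eventually.of_forall fun ω => ?_)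
    · have hcont : Continuous fun x => residual K (meanOp P F) (α n) x ^ 2 := by
        unfold residual
        fun_prop
      exact (hcont.measurable.comp (hXm n)).aestronglyMeasurable
    · rw [Real.norm_of_nonneg (sq_nonneg _)]
      exact hrle n ω
  have hrsum : Summable fun n => ∫ ω, r n ω ^ 2 ∂μ := by
    refine Summable.of_nonneg_of_le (fun n => integral_nonneg fun ω => sq_nonneg _) (fun n => ?_)
      ((hq.mul_left 2).add (hw.mul_left (2 * a ^ 2)))
    refine (integral_mono (hrint n) ((i1 n).add (i2 n)) (hrle n)).trans (le_of_eq ?_)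
    simp only [Pi.add_apply]
    rw [integral_add (i1 n) (i2 n), integral_const_mul, integral_const_mul]
  refine ⟨?_, hrint, hrsum.tendsto_atTop_zero⟩
  have hr0 : ∀ᵐ ω ∂μ, Tendsto (fun n => r n ω) atTop (𝓝 0) := by
    have := ae_summable_of_summable_integral_norm hrint (by
      simpa only [Real.norm_of_nonneg (sq_nonneg _)] using hrsum)
    filter_upwards [this] with ω hω
    have h := (Real.continuous_sqrt.tendsto 0).comp hω.tendsto_atTop_zero
    rw [Real.sqrt_zero] at h
    exact h.congr fun n => Real.sqrt_sq (norm_nonneg _)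
  -- The exceptional null set depends on the solution, hence the passage to countably many.
  obtain ⟨D, hDS, hDc, hSD⟩ := (TopologicalSpace.IsSeparable.of_separableSpace
    (solutionSet (meanOp P F) K)).exists_countable_dense_subset
  have hDne : D.Nonempty := closure_nonempty_iff.1 ⟨p, hSD hp⟩
  have hall : ∀ᵐ ω ∂μ, ∀ q ∈ D, ∃ l, Tendsto (fun n => ‖X n ω - q‖) atTop (𝓝 l) := by
    refine (ae_ball_iff hDc).2 fun q hqD => ?_
    obtain ⟨c', hc0', hvar'⟩ := hvar q (hDS hqD)
    exact (summable_and_ae_tendsto_norm_sub hne hc hconv hLip hmono hF hFint (hDS hqD) hc0'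
      hvar' hα0 hαmax hαL hm hbatch hs hX₀).2.2
  filter_upwards [hr0, hall] with ω hω1 hω2
  refine exists_tendsto_of_forall_dist_tendsto hDne hSD hω2 fun q φ hφ hq => ?_
  exact mem_solutionSet_of_tendsto_residual hne hc hconv hT hαmin (fun n => hα (φ n)) hq
    (hω1.comp hφ.tendsto_atTop)

theorem iterate_congr {Ω Ξ : Type*} {ξ η : ℕ → ℕ → Ω → Ξ} {F F' : Vec d → Ξ → Vec d}
    {X₀ X₀' : Ω → Vec d} {ω : Ω} (h₀ : X₀ ω = X₀' ω)
    (h : ∀ j : SampleIdx m, ∀ x, F x (sampleFamily m ξ η j ω) = F' x (sampleFamily m ξ η j ω))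
    (n : ℕ) : iterate K F α m ξ η X₀ n ω = iterate K F' α m ξ η X₀' n ω := by
  have hb : ∀ (M : ℕ) (s : ℕ → Ξ), (∀ i ∈ Finset.Icc 1 M, ∀ x, F x (s i) = F' x (s i)) →
      batchMean F M s = batchMean F' M s := by
    intro M s hs
    funext x
    unfold batchMean
    congr 1
    exact Finset.sum_congr rfl fun i hi => hs i hi x
  induction n with
  | zero => exact h₀
  | succ n ih =>
    have h1 := hb (m (n + 1)) (fun i => ξ (n + 1) i ω) fun i hi => h (mkIdx m n true hi)
    have h2 := hb (m (n + 1)) (fun i => η (n + 1) i ω) fun i hi => h (mkIdx m n false hi)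
    simp only [iterate, step, ih, h1, h2]

/-- The iterates are determined pathwise by the starting point, so truncating the starting point
removes the integrability assumption. -/
theorem ae_converges (hsol : (solutionSet (meanOp P F) K).Nonempty) (hne : K.Nonempty)
    (hc : IsClosed K) (hconv : Convex ℝ K) (hLip : LipschitzWith L (meanOp P F))
    (hmono : PseudoMonotone (meanOp P F)) (hF : Measurable (Function.uncurry F))
    (hFint : ∀ x, Integrable (F x) P)
    (hvar : ∀ p ∈ solutionSet (meanOp P F) K, ∃ c : ℝ, 0 ≤ c ∧ ∀ x,
      ∫⁻ z, ‖F x z - meanOp P F x‖ₑ ^ 2 ∂P ≤ ENNReal.ofReal (c * (1 + ‖x - p‖ ^ 2)))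
    {αmin αmax : ℝ} (hαmin : 0 < αmin) (hα : ∀ n, αmin ≤ α n) (hαmax : ∀ n, α (n + 1) ≤ αmax)
    (hαL : 2 * αmax ^ 2 * (L : ℝ) ^ 2 < 1) (hm : ∀ n, 1 ≤ m (n + 1))
    (hbatch : Summable fun n : ℕ => 1 / (m (n + 1) : ℝ)) (hs : IsSampling μ P m ξ η X₀) :
    ∀ᵐ ω ∂μ, ∃ q ∈ solutionSet (meanOp P F) K,
      Tendsto (fun n => iterate K F α m ξ η X₀ n ω) atTop (𝓝 q) := by
  set g : ℕ → Vec d → Vec d := fun R => (Metric.closedBall 0 (R : ℝ)).indicator id with hg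
  have hgm : ∀ R, Measurable (g R) := fun R =>
    measurable_id.indicator Metric.isClosed_closedBall.measurableSet
  have hs' : ∀ R, IsSampling μ P m ξ η (g R ∘ X₀) := fun R =>
    { measurable_init := (hgm R).comp hs.measurable_init
      measurable_sample := hs.measurable_sample
      law_sample := hs.law_sample
      indep_samples := hs.indep_samples
      indep_init := hs.indep_init.comp (hgm R) measurable_id }
  have hmem : ∀ R, MemLp (g R ∘ X₀) 2 μ := fun R => by
    refine MemLp.of_bound ((hgm R).comp hs.measurable_init).aestronglyMeasurable (R : ℝ)
      (Eventually.of_forall fun ω => ?_)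
    by_cases h : X₀ ω ∈ Metric.closedBall (0 : Vec d) (R : ℝ)
    · simpa only [hg, Function.comp_apply, Set.indicator_of_mem h, id] using
        mem_closedBall_zero_iff.1 h
    · simp [hg, Set.indicator_of_notMem h]
  have hconv := fun R => (converges_of_memLp hsol hne hc hconv hLip hmono hF hFint hvar hαmin hα
    hαmax hαL hm hbatch (hs' R) (hmem R)).1
  filter_upwards [ae_all_iff.2 hconv] with ω hω
  obtain ⟨R, hR⟩ := exists_nat_ge ‖X₀ ω‖
  obtain ⟨q, hqS, hq⟩ := hω R
  refine ⟨q, hqS, hq.congr fun n => iterate_congr ?_ (fun _ _ => rfl) n⟩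
  have h : X₀ ω ∈ Metric.closedBall (0 : Vec d) (R : ℝ) := by simpa using hR
  simp [hg, h]

end Convergence

/-- The `p`-th moment condition with `p ≥ 2` bounds the variance of the oracle. -/
theorem VarianceControl.lintegral_le {d : ℕ} {Ξ : Type*} [MeasurableSpace Ξ] {P : Measure Ξ}
    [IsProbabilityMeasure P] {F : Vec d → Ξ → Vec d} {K : Set (Vec d)}
    (h : VarianceControl P F K) (hFint : ∀ x, Integrable (F x) P) {p : Vec d}
    (hp : p ∈ solutionSet (meanOp P F) K) :
    ∃ c : ℝ, 0 ≤ c ∧ ∀ x,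
      ∫⁻ z, ‖F x z - meanOp P F x‖ₑ ^ 2 ∂P ≤ ENNReal.ofReal (c * (1 + ‖x - p‖ ^ 2)) := by
  obtain ⟨e, σ₀, σ, he, hσ₀, hσ, -, -, hle⟩ := h
  set s := σ ⟨p, hp⟩
  have hs : 0 ≤ s := hσ _
  refine ⟨2 * (s ^ 2 + σ₀ ^ 2), by positivity, fun x => ?_⟩
  have h2 : (2 : ℝ≥0∞) ≤ ENNReal.ofReal e := by
    rw [← ENNReal.ofReal_ofNat]
    exact ENNReal.ofReal_le_ofReal he
  have h3 : eLpNorm (fun z => F x z - meanOp P F x) 2 P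
      ≤ ENNReal.ofReal (s + σ₀ * ‖x - p‖) :=
    (eLpNorm_le_eLpNorm_of_exponent_le h2
      ((hFint x).sub (integrable_const _)).aestronglyMeasurable).trans (hle x ⟨p, hp⟩)
  have h4 : eLpNorm (fun z => F x z - meanOp P F x) 2 P ^ 2
      = ∫⁻ z, ‖F x z - meanOp P F x‖ₑ ^ 2 ∂P := by
    have := eLpNorm_nnreal_pow_eq_lintegral (μ := P) (f := fun z => F x z - meanOp P F x)
      (p := 2) two_ne_zero
    simpa using this
  rw [← h4]
  calc eLpNorm (fun z => F x z - meanOp P F x) 2 P ^ 2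
      ≤ ENNReal.ofReal (s + σ₀ * ‖x - p‖) ^ 2 := by gcongr
    _ = ENNReal.ofReal ((s + σ₀ * ‖x - p‖) ^ 2) := (ENNReal.ofReal_pow (by positivity) 2).symm
    _ ≤ _ := by
      refine ENNReal.ofReal_le_ofReal ?_
      nlinarith [sq_nonneg (s - σ₀ * ‖x - p‖), mul_nonneg (sq_nonneg s) (sq_nonneg ‖x - p‖),
        sq_nonneg σ₀]

/-- A Carathéodory map agrees, for almost every `z` and then for all `x`, with a jointly
measurable map. -/
theorem IsCaratheodory.exists_measurable {d : ℕ} {Ξ : Type*} [MeasurableSpace Ξ] {P : Measure Ξ}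
    {F : Vec d → Ξ → Vec d} (hF : IsCaratheodory P F) :
    ∃ F' : Vec d → Ξ → Vec d, Measurable (Function.uncurry F') ∧ ∀ᵐ z ∂P, ∀ x, F x z = F' x z := by
  set t := toMeasurable P {z | ¬ Continuous fun x => F x z} with ht
  have ht0 : P t = 0 := by
    rw [ht, measure_toMeasurable]
    exact hF.1
  have htm : MeasurableSet t := measurableSet_toMeasurable _ _
  refine ⟨fun x => tᶜ.indicator (F x), ?_, ?_⟩
  · refine measurable_uncurry_of_continuous_of_measurable (fun z => ?_)
      fun x => (hF.2 x).indicator htm.compl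
    by_cases hz : z ∈ t
    · simpa [hz] using continuous_const
    · have hc : Continuous fun x => F x z := by
        by_contra hcon
        exact hz (subset_toMeasurable _ _ hcon)
      simpa [hz] using hc
  · filter_upwards [measure_eq_zero_iff_ae_notMem.1 ht0] with z hz x
    simp [hz]

end SFBF

theorem mainTheorem1 {d : ℕ} {Ω Ξ : Type*} [MeasurableSpace Ω] [MeasurableSpace Ξ]
    (μ : Measure Ω) [IsProbabilityMeasure μ] (P : Measure Ξ) [IsProbabilityMeasure P]
    (K : Set (SFBF.Vec d)) (F : SFBF.Vec d → Ξ → SFBF.Vec d) (L : ℝ≥0)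
    (α : ℕ → ℝ) (m : ℕ → ℕ) (ξ η : ℕ → ℕ → Ω → Ξ) (X₀ : Ω → SFBF.Vec d)
    (hsol : (SFBF.solutionSet (SFBF.meanOp P F) K).Nonempty)
    (hKne : K.Nonempty) (hKclosed : IsClosed K) (hKconv : Convex ℝ K)
    (hF : SFBF.IsCaratheodory P F) (hFint : ∀ x, Integrable (F x) P)
    (hL : 0 < L) (hLip : LipschitzWith L (SFBF.meanOp P F))
    (hmono : SFBF.PseudoMonotone (SFBF.meanOp P F))
    (hstep : ∃ αmin αmax : ℝ, 0 < αmin ∧ (∀ n, αmin ≤ α n) ∧ (∀ n, 1 ≤ n → α n ≤ αmax) ∧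
      αmax < 1 / (√2 * (L : ℝ)))
    (hmpos : ∀ n, 1 ≤ n → 1 ≤ m n) (hbatch : Summable fun n : ℕ => 1 / (m (n + 1) : ℝ))
    (hvar : SFBF.VarianceControl P F K)
    (hsample : SFBF.IsSampling μ P m ξ η X₀) :
    (∃ X : Ω → SFBF.Vec d, Measurable X ∧
      (∀ ω, X ω ∈ SFBF.solutionSet (SFBF.meanOp P F) K) ∧
      ∀ᵐ ω ∂μ, Tendsto (fun n => SFBF.iterate K F α m ξ η X₀ n ω) atTop (𝓝 (X ω))) ∧
    (MemLp X₀ 2 μ →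
      (∀ n, Integrable
        (fun ω => SFBF.residual K (SFBF.meanOp P F) (α n)
          (SFBF.iterate K F α m ξ η X₀ n ω) ^ 2) μ) ∧
      Tendsto
        (fun n => ∫ ω, SFBF.residual K (SFBF.meanOp P F) (α n)
          (SFBF.iterate K F α m ξ η X₀ n ω) ^ 2 ∂μ)
        atTop (𝓝 0)) := by
  obtain ⟨αmin, αmax, hαmin, hα, hαmax', hαL'⟩ := hstep
  have hαmax : ∀ n, α (n + 1) ≤ αmax := fun n => hαmax' _ (Nat.le_add_left 1 n)
  have hm : ∀ n, 1 ≤ m (n + 1) := fun n => hmpos _ (Nat.le_add_left 1 n)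
  have hαL : 2 * αmax ^ 2 * (L : ℝ) ^ 2 < 1 := by
    have hL0 : (0 : ℝ) < L := hL
    have h0 : 0 < αmax := hαmin.trans_le ((hα 1).trans (hαmax 0))
    rw [lt_div_iff₀ (by positivity)] at hαL'
    have h1 := pow_lt_pow_left₀ hαL' (by positivity) two_ne_zero
    have h2 : (√2 : ℝ) ^ 2 = 2 := Real.sq_sqrt (by norm_num)
    calc 2 * αmax ^ 2 * (L : ℝ) ^ 2 = (αmax * (√2 * L)) ^ 2 := by rw [mul_pow, mul_pow, h2]; ring
      _ < 1 := by simpa using h1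
  obtain ⟨F', hF'm, hFF'⟩ := hF.exists_measurable
  have hae : ∀ x, F x =ᵐ[P] F' x := fun x => hFF'.mono fun z hz => hz x
  have hT : SFBF.meanOp P F = SFBF.meanOp P F' := funext fun x => integral_congr_ae (hae x)
  have hvar' : ∀ p ∈ SFBF.solutionSet (SFBF.meanOp P F') K, ∃ c : ℝ, 0 ≤ c ∧ ∀ x,
      ∫⁻ z, ‖F' x z - SFBF.meanOp P F' x‖ₑ ^ 2 ∂P
        ≤ ENNReal.ofReal (c * (1 + ‖x - p‖ ^ 2)) := by
    rw [← hT]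
    intro p hp
    obtain ⟨c, hc0, hc⟩ := hvar.lintegral_le hFint hp
    refine ⟨c, hc0, fun x => le_of_eq_of_le (lintegral_congr_ae ?_) (hc x)⟩
    filter_upwards [hae x] with z hz
    rw [hz]
  have hF'int : ∀ x, Integrable (F' x) P := fun x => (hFint x).congr (hae x)
  -- Almost surely, no sample falls into the null set where the two maps differ.
  have hiter : ∀ᵐ ω ∂μ, ∀ n,
      SFBF.iterate K F α m ξ η X₀ n ω = SFBF.iterate K F' α m ξ η X₀ n ω := by
    have hgood : ∀ᵐ ω ∂μ, ∀ j : SFBF.SampleIdx m, ∀ x,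
        F x (SFBF.sampleFamily m ξ η j ω) = F' x (SFBF.sampleFamily m ξ η j ω) :=
      ae_all_iff.2 fun j => ae_of_ae_map (hsample.measurable_sample j).aemeasurable
        (by rw [hsample.law_sample j]; exact hFF')
    filter_upwards [hgood] with ω hω n
    exact SFBF.iterate_congr rfl hω n
  rw [hT] at hsol hLip hmono ⊢
  have hlim := SFBF.ae_converges hsol hKne hKclosed hKconv hLip hmono hF'm hF'int hvar' hαmin hα
    hαmax hαL hm hbatch hsample
  refine ⟨?_, fun hX₀ => ?_⟩
  · have hXm : ∀ n, Measurable (SFBF.iterate K F' α m ξ η X₀ n) := fun n =>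
      (SFBF.measurable_info_iterate hF'm
        (SFBF.lipschitzWith_proj hKne hKclosed hKconv).continuous.measurable n).mono
        (hsample.info_le _) le_rfl
    -- The limit is redefined on a null set, so that its values are solutions everywhere.
    obtain ⟨G, hGm, hG⟩ := measurable_limit_of_tendsto_metrizable_ae
      (fun n => (hXm n).aemeasurable) (hlim.mono fun ω ⟨q, _, hq⟩ => ⟨q, hq⟩)
    have hS := (SFBF.isClosed_solutionSet hKclosed hLip.continuous).measurableSet
    obtain ⟨p, hp⟩ := hsol
    classical
    refine ⟨fun ω => if G ω ∈ SFBF.solutionSet (SFBF.meanOp P F') K then G ω else p,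
      Measurable.ite (hGm hS) hGm measurable_const, fun ω => ?_, ?_⟩
    · dsimp only
      split_ifs with h
      · exact h
      · exact hp
    · filter_upwards [hlim, hG, hiter] with ω ⟨q, hqS, hq⟩ hGω hω
      have hGq : G ω = q := tendsto_nhds_unique hGω hq
      rw [if_pos (hGq ▸ hqS)]
      exact hGω.congr fun n => (hω n).symm
  · obtain ⟨-, h1, h2⟩ := SFBF.converges_of_memLp hsol hKne hKclosed hKconv hLip hmono hF'm hF'int
      hvar' hαmin hα hαmax hαL hm hbatch hsample hX₀
    have heq : ∀ n, (fun ω => SFBF.residual K (SFBF.meanOp P F') (α n)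
        (SFBF.iterate K F' α m ξ η X₀ n ω) ^ 2) =ᵐ[μ]
        fun ω => SFBF.residual K (SFBF.meanOp P F') (α n)
          (SFBF.iterate K F α m ξ η X₀ n ω) ^ 2 := fun n => by
      filter_upwards [hiter] with ω hω
      rw [hω n]
    exact ⟨fun n => (h1 n).congr (heq n), h2.congr fun n => integral_congr_ae (heq n)⟩
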